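/- Let $(Z_i^{(1)})_{i\ge 1}$ and $(Z_i^{(2)})_{i\ge 1}$ be two sequences of i.i.d. random vectors in $\mathbb{R}^2$ with finite second moments, $\mathbb{E}\|Z_1^{(k)}\|^2<\infty$; the two sequences are independent of each other, and the laws of $Z_1^{(1)}$ and $Z_1^{(2)}$ may differ. Put $S_0^{(k)}=0$, $S_n^{(k)}=\sum_{i=1}^n Z_i^{(k)}$ for $k=1,2$, and let $$L_n=\operatorname{Per}\bigl(\operatorname{chull}\{S_j^{(k)}:0\le j\le n,\ k=1,2\}\bigr)$$ be the perimeter of the convex hull of the two random walks up to time $n$, that is, the sum of the lengths of the sides of this convex polygon; if the hull is a line segment, its perimeter is twice its length, and if it is a point, its perimeter is $0$. Let $\boldsymbol\mu^{(k)}=\mathbb{E}[Z_1^{(k)}]$ and $\boldsymbol\Sigma^{(k)}=\mathbb{E}[(Z_1^{(k)}-\boldsymbol\mu^{(k)})(Z_1^{(k)}-\boldsymbol\mu^{(k)})^T]$, and assume $$\boldsymbol 0\notin\{\boldsymbol\mu^{(1)},\ \boldsymbol\mu^{(2)},\ \boldsymbol\mu^{(1)}-\boldsymbol\mu^{(2)}\}.$$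 Write $\mathbf e_\theta=(\cos\theta,\sin\theta)$. Let $\theta^{(k)}\in[0,2\pi)$ be the angle with $\boldsymbol\mu^{(k)}=\|\boldsymbol\mu^{(k)}\|\,\mathbf e_{\theta^{(k)}}$ for $k=1,2$, let $\theta^{(0)}\in[0,2\pi)$ be an angle with $\boldsymbol\mu^{(1)}\cdot\mathbf e_{\theta^{(0)}}=\boldsymbol\mu^{(2)}\cdot\mathbf e_{\theta^{(0)}}$, and let $\mathbf e_{\theta^{(0)}}^\perp$ be the unit vector perpendicular to $\mathbf e_{\theta^{(0)}}$ with $\mathbf e_{\theta^{(0)}}^\perp\cdot(\boldsymbol\mu^{(1)}-\boldsymbol\mu^{(2)})\ge 0$ (so that $\mathbf e_{\theta^{(0)}}^\perp=(\boldsymbol\mu^{(1)}-\boldsymbol\mu^{(2)})/\|\boldsymbol\mu^{(1)}-\boldsymbol\mu^{(2)}\|$). Define \begin{align*} \sigma_L^2={}&\mathbb{E}[((Z_1^{(1)}-\boldsymbol\mu^{(1)})\cdot\mathbf e_{\theta^{(1)}})^2]+\mathbb{E}[((Z_1^{(1)}-\boldsymbol\mu^{(1)})\cdot\mathbf e_{\theta^{(0)}}^\perp)^2]+2(\boldsymbol\Sigma^{(1)}\mathbf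 e_{\theta^{(1)}})\cdot\mathbf e_{\theta^{(0)}}^\perp\\ &+\mathbb{E}[((Z_1^{(2)}-\boldsymbol\mu^{(2)})\cdot\mathbf e_{\theta^{(2)}})^2]+\mathbb{E}[((Z_1^{(2)}-\boldsymbol\mu^{(2)})\cdot\mathbf e_{\theta^{(0)}}^\perp)^2]-2(\boldsymbol\Sigma^{(2)}\mathbf e_{\theta^{(2)}})\cdot\mathbf e_{\theta^{(0)}}^\perp, \end{align*} and assume $\sigma_L^2>0$. Then every $L_n$ is a random variable with finite second moment, and for every $x\in\mathbb{R}$ $$\lim_{n\to\infty}\mathbb{P}\left[\frac{L_n-\mathbb{E}[L_n]}{\sqrt{\operatorname{Var}[L_n]}}\le x\right]=\lim_{n\to\infty}\mathbb{P}\left[\frac{L_n-\mathbb{E}[L_n]}{\sqrt{\sigma_L^2\,n}}\le x\right]=\Phi(x),$$ where $\Phi$ is the cumulative distribution function of the standard normal distribution. -/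

import Mathlib

open MeasureTheory ProbabilityTheory Filter Topology

noncomputable section

/-- The Euclidean plane. -/
abbrev Plane : Type := EuclideanSpace ℝ (Fin 2)

/-- The unit vector `(cos θ, sin θ)`. -/
def unitVec (θ : ℝ) : Plane := !₂[Real.cos θ, Real.sin θ]

/-- The planar cross product `v₀ w₁ - v₁ w₀`; it is nonnegative when `w` points into the closed
half-plane to the left of the direction `v`. -/
def planeCross (v w : Plane) : ℝ := v 0 * w 1 - v 1 * w 0

/-- The sides of a convex polygon `K`, as ordered pairs `(p, q)` of endpoints, listed in
counterclockwise order: `p ≠ q` are points of `K`, all of `K` lies in the closed half-plane to the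
left of the line from `p` to `q`, and this line meets `K` exactly in the segment `[p, q]`.
A nondegenerate polygon has each of its sides listed once. A segment `[a, b]` with `a ≠ b`, regarded
as a degenerate polygon, has the two sides `(a, b)` and `(b, a)`; a single point has no side. -/
def polygonSides (K : Set Plane) : Set (Plane × Plane) :=
  {e | e.1 ∈ K ∧ e.2 ∈ K ∧ e.1 ≠ e.2 ∧
    (∀ x ∈ K, 0 ≤ planeCross (e.2 - e.1) (x - e.1)) ∧
    (∀ x ∈ K, planeCross (e.2 - e.1) (x - e.1) = 0 → x ∈ segment ℝ e.1 e.2)}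

/-- The perimeter of a (possibly degenerate) convex polygon: the sum of the lengths of its sides.
The perimeter of a segment is twice its length. -/
def polygonPerimeter (K : Set Plane) : ℝ :=
  ∑ᶠ e ∈ polygonSides K, dist e.1 e.2

variable {Ω : Type*}

/-- The random walk `S₀ = 0`, `Sₙ = Z₁ + ⋯ + Zₙ`. The steps are indexed from `0` here, so that
`Z i` is the step `Z_{i+1}`. -/
def walk (Z : ℕ → Ω → Plane) (n : ℕ) (ω : Ω) : Plane := ∑ i ∈ Finset.range n, Z i ω

/-- The convex hull of the positions of two walks up to time `n`. -/
def walksHull (Z₁ Z₂ : ℕ → Ω → Plane) (n : ℕ) (ω : Ω) : Set Plane :=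
  convexHull ℝ ({x | ∃ j ≤ n, x = walk Z₁ j ω} ∪ {x | ∃ j ≤ n, x = walk Z₂ j ω})

/-- The perimeter process `L n`. -/
def perimeterProcess (Z₁ Z₂ : ℕ → Ω → Plane) (n : ℕ) (ω : Ω) : ℝ :=
  polygonPerimeter (walksHull Z₁ Z₂ n ω)

variable [MeasurableSpace Ω]

/-- The mean vector `E[X]`. -/
def meanVec (P : Measure Ω) (X : Ω → Plane) : Plane := ∫ ω, X ω ∂P

/-- The covariance matrix `E[(X - E X) (X - E X)ᵀ]`. -/
def covMatrix (P : Measure Ω) (X : Ω → Plane) : Matrix (Fin 2) (Fin 2) ℝ :=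
  Matrix.of fun i j => ∫ ω, (X ω - meanVec P X) i * (X ω - meanVec P X) j ∂P

/-- The limiting variance `σ_L²`, for steps distributed as `X₁` and `X₂`, where `e₁`, `e₂` are
the directions of the two drift vectors and `p` is the direction of the third side of the
triangle spanned by them. -/
def sigmaLSq (P : Measure Ω) (X₁ X₂ : Ω → Plane) (e₁ e₂ p : Plane) : ℝ :=
  (∫ ω, (inner ℝ (X₁ ω - meanVec P X₁) e₁) ^ 2 ∂P)
    + (∫ ω, (inner ℝ (X₁ ω - meanVec P X₁) p) ^ 2 ∂P)
    + 2 * inner ℝ ((covMatrix P X₁).toEuclideanLin e₁) p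
    + (∫ ω, (inner ℝ (X₂ ω - meanVec P X₂) e₂) ^ 2 ∂P)
    + (∫ ω, (inner ℝ (X₂ ω - meanVec P X₂) p) ^ 2 ∂P)
    - 2 * inner ℝ ((covMatrix P X₂).toEuclideanLin e₂) p

end

/-! By Cauchy's formula (`polygonPerimeter_convexHull`) the perimeter is half the integral, over all
directions `unitVec θ`, of the width of the hull. The width in one direction is the range of the
union of two walks on the line.

In almost every direction the two projected walks and their difference all have nonzero drift. A
walk on the line with nonzero drift rarely strays beyond its endpoints: its range exceeds its
displacement, signed by the drift, by a nonnegative `excess` that is `o(√n)` in L²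
(`excess_moments`). Hence, up to excesses, the width is that of the triangle with vertices 0,
S_n^(1), S_n^(2). This is half the sum of the lengths of its three projected sides, and with the
signs frozen at those of the drifts it is linear in the endpoints (`spread_disjSum_bounds`). Since ∫
sign(ν·e_θ) (v·e_θ) dθ = 4 v·ν/‖ν‖, integration turns each frozen sign into a unit vector. So L_n
equals S_n^(1)·e₁ + S_n^(2)·e₂ + (S_n^(1) - S_n^(2))·p up to `o(√n)` in L², where e₁, e₂, p are the
normalized drifts and their normalized difference (`perimeterProcess_approx`). The main term is a
sum of i.i.d. variables of variance σ_L², and the classical central limit theorem with Slutsky's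
lemma concludes (`tendsto_cdf_of_approx_partialSum`).

Only second moments are available for the excess. A step is written as drift, plus a bounded
centered part, plus a centered part of variance at most a small multiple of ε. The first two make up
a walk whose backward excursions have exponential moments, hence second moments bounded in n. The
last costs at most εn, by Doob's inequality. -/

/-! ### Sides of a convex polygon and the lines that cross them. -/

lemma Plane.inner_eq (x y : Plane) : inner ℝ x y = x 0 * y 0 + x 1 * y 1 := by
  simp only [PiLp.inner_apply, Fin.sum_univ_two, RCLike.inner_apply, conj_trivial]
  ring

lemma Plane.ext_iff (x y : Plane) : x = y ↔ x 0 = y 0 ∧ x 1 = y 1 := by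
  constructor
  · rintro rfl; simp
  · rintro ⟨h0, h1⟩
    ext i
    fin_cases i
    · exact h0
    · exact h1

lemma left_mem_extremePoints_segment {E : Type*} [AddCommGroup E] [Module ℝ E] (p q : E) :
    p ∈ (segment ℝ p q).extremePoints ℝ := by
  rcases eq_or_ne p q with rfl | hpq
  · simp
  rw [mem_extremePoints_iff_left]
  refine ⟨left_mem_segment ℝ p q, ?_⟩
  rintro x hx y hy ⟨a, b, ha, hb, hab, h⟩
  rw [segment_eq_image'] at hx hy
  obtain ⟨s, ⟨hs, -⟩, rfl⟩ := hx
  obtain ⟨t, ⟨ht, -⟩, rfl⟩ := hy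
  have h0 : (a * s + b * t) • (q - p) = 0 := by
    have hp : p = a • p + b • p := by rw [← add_smul, hab, one_smul]
    have : (a * s + b * t) • (q - p)
        = (a • (p + s • (q - p)) + b • (p + t • (q - p))) - (a • p + b • p) := by module
    rw [this, h, ← hp, sub_self]
  have h1 : a * s + b * t = 0 := (smul_eq_zero.1 h0).resolve_right (sub_ne_zero.2 hpq.symm)
  have h2 : s = 0 := by
    by_contra hne
    have : 0 < a * s := mul_pos ha (lt_of_le_of_ne hs (Ne.symm hne))
    nlinarith [mul_nonneg hb.le ht]
  simp [h2]

/-- A side is a face: `planeCross` relative to it is nonnegative on `K` and vanishes on `K` only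
along the side. For the hull of a finite set this makes the endpoints members of that set, so there
are finitely many sides. -/
lemma mem_extremePoints_of_mem_polygonSides {K : Set Plane} (hK : Convex ℝ K) {e : Plane × Plane}
    (he : e ∈ polygonSides K) : e.1 ∈ K.extremePoints ℝ ∧ e.2 ∈ K.extremePoints ℝ := by
  obtain ⟨p, q⟩ := e
  obtain ⟨hp, hq, hpq, hpos, hseg⟩ := he
  simp only at hp hq hpq hpos hseg ⊢
  have key : ∀ x ∈ K, ∀ y ∈ K, ∀ z ∈ segment ℝ p q, z ∈ openSegment ℝ x y →
      x ∈ segment ℝ p q := by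
    rintro x hx y hy z ⟨c, d, hc, hd, hcd, rfl⟩ ⟨a, b, ha, hb, hab, hz⟩
    have hx0 := hpos x hx
    have hy0 := hpos y hy
    have hb' : b = 1 - a := by linarith
    have hd' : d = 1 - c := by linarith
    have hz0 : a * planeCross (q - p) (x - p) + b * planeCross (q - p) (y - p) = 0 := by
      have h0 := congrArg (fun v : Plane => v 0) hz
      have h1 := congrArg (fun v : Plane => v 1) hz
      simp only [PiLp.add_apply, PiLp.smul_apply, smul_eq_mul] at h0 h1
      simp only [planeCross, PiLp.sub_apply]
      subst hb' hd'
      linear_combination (q 0 - p 0) * h1 - (q 1 - p 1) * h0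
    have hx1 : planeCross (q - p) (x - p) = 0 := by
      nlinarith [mul_nonneg ha.le hx0, mul_nonneg hb.le hy0]
    exact hseg x hx hx1
  have hext : IsExtreme ℝ K (segment ℝ p q) := ⟨hK.segment_subset hp hq, key⟩
  refine ⟨hext.extremePoints_subset_extremePoints (left_mem_extremePoints_segment p q),
    hext.extremePoints_subset_extremePoints ?_⟩
  rw [segment_symm]
  exact left_mem_extremePoints_segment q p

lemma mem_of_mem_polygonSides_convexHull {F : Set Plane} {e : Plane × Plane}
    (he : e ∈ polygonSides (convexHull ℝ F)) : e.1 ∈ F ∧ e.2 ∈ F :=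
  ⟨extremePoints_convexHull_subset
      (mem_extremePoints_of_mem_polygonSides (convex_convexHull ℝ F) he).1,
    extremePoints_convexHull_subset
      (mem_extremePoints_of_mem_polygonSides (convex_convexHull ℝ F) he).2⟩

lemma finite_polygonSides_convexHull {F : Set Plane} (hF : F.Finite) :
    (polygonSides (convexHull ℝ F)).Finite :=
  (hF.prod hF).subset fun _ he => Set.mem_prod.2 (mem_of_mem_polygonSides_convexHull he)

/-- A line transverse to `u` crosses at most one side of a convex set in the direction `u`. -/
lemma polygonSides_eq_of_crossing {K : Set Plane} {u : Plane} {t : ℝ}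
    {e e' : Plane × Plane} (he : e ∈ polygonSides K) (he' : e' ∈ polygonSides K)
    (h : inner ℝ e.1 u < t ∧ t < inner ℝ e.2 u) (h' : inner ℝ e'.1 u < t ∧ t < inner ℝ e'.2 u) :
    e = e' := by
  -- each of the two lines through the crossing points supports `K`
  have key : ∀ e ∈ polygonSides K, ∀ e' ∈ polygonSides K,
      0 ≤ planeCross (e.2 - e.1) (e'.2 - e.1) ∧ 0 ≤ planeCross (e.2 - e.1) (e'.1 - e.1) := by
    rintro e ⟨-, -, -, hpos, -⟩ e' ⟨h1, h2, -, -, -⟩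
    exact ⟨hpos _ h2, hpos _ h1⟩
  obtain ⟨k1, k2⟩ := key e he e' he'
  obtain ⟨k3, k4⟩ := key e' he' e he
  have a1 : 0 < t - inner ℝ e'.1 u := by linarith
  have a2 : 0 < inner ℝ e'.2 u - t := by linarith
  have a3 : 0 < t - inner ℝ e.1 u := by linarith
  have a4 : 0 < inner ℝ e.2 u - t := by linarith
  -- Up to positive factors, each half evaluates the supporting functional of one side at the point
  -- where the other side meets the level line. The two crossing points differ by a multiple of the
  -- normal to `u`, so the two halves are opposite. Being nonnegative, all four terms vanish.
  have hsum : (t - inner ℝ e'.1 u) * planeCross (e.2 - e.1) (e'.2 - e.1)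
        + (inner ℝ e'.2 u - t) * planeCross (e.2 - e.1) (e'.1 - e.1)
      + ((t - inner ℝ e.1 u) * planeCross (e'.2 - e'.1) (e.2 - e'.1)
        + (inner ℝ e.2 u - t) * planeCross (e'.2 - e'.1) (e.1 - e'.1)) = 0 := by
    simp only [planeCross, Plane.inner_eq, PiLp.sub_apply]
    ring
  have m1 := mul_nonneg a1.le k1
  have m2 := mul_nonneg a2.le k2
  have m3 := mul_nonneg a3.le k3
  have m4 := mul_nonneg a4.le k4
  have z1 := (mul_eq_zero.1 (by linarith : (t - inner ℝ e'.1 u) *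
    planeCross (e.2 - e.1) (e'.2 - e.1) = 0)).resolve_left a1.ne'
  have z2 := (mul_eq_zero.1 (by linarith : (inner ℝ e'.2 u - t) *
    planeCross (e.2 - e.1) (e'.1 - e.1) = 0)).resolve_left a2.ne'
  have z3 := (mul_eq_zero.1 (by linarith : (t - inner ℝ e.1 u) *
    planeCross (e'.2 - e'.1) (e.2 - e'.1) = 0)).resolve_left a3.ne'
  have z4 := (mul_eq_zero.1 (by linarith : (inner ℝ e.2 u - t) *
    planeCross (e'.2 - e'.1) (e.1 - e'.1) = 0)).resolve_left a4.ne'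
  obtain ⟨p1, p2, -, -, hs⟩ := he
  obtain ⟨p1', p2', -, -, hs'⟩ := he'
  have s1 := hs _ p2' z1
  have s2 := hs _ p1' z2
  have s3 := hs' _ p2 z3
  have s4 := hs' _ p1 z4
  have mono : ∀ p q x : Plane, inner ℝ p u < inner ℝ q u → x ∈ segment ℝ p q →
      inner ℝ p u ≤ inner ℝ x u ∧ inner ℝ x u ≤ inner ℝ q u ∧
      (inner ℝ x u ≤ inner ℝ p u → x = p) ∧ (inner ℝ q u ≤ inner ℝ x u → x = q) := by
    rintro p q x hpq ⟨a, b, ha, hb, hab, rfl⟩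
    have hb' : b = 1 - a := by linarith
    subst hb'
    rw [inner_add_left, real_inner_smul_left, real_inner_smul_left]
    refine ⟨by nlinarith, by nlinarith, fun h => ?_, fun h => ?_⟩
    · have : a = 1 := by nlinarith
      simp [this]
    · have : a = 0 := by nlinarith
      simp [this]
  have l1 := mono _ _ _ (by linarith : inner ℝ e.1 u < inner ℝ e.2 u) s1
  have l2 := mono _ _ _ (by linarith : inner ℝ e.1 u < inner ℝ e.2 u) s2
  have l3 := mono _ _ _ (by linarith : inner ℝ e'.1 u < inner ℝ e'.2 u) s3
  have l4 := mono _ _ _ (by linarith : inner ℝ e'.1 u < inner ℝ e'.2 u) s4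
  exact Prod.ext (l2.2.2.1 l4.1).symm (l1.2.2.2 l3.2.1).symm

/-- A line transverse to `u` which meets a polygon but avoids its vertices crosses some side in the
direction `u`. -/
lemma exists_polygonSides_crossing (F : Finset Plane) (u : Plane) (t : ℝ)
    (hlt : ∃ p ∈ F, inner ℝ p u < t) (hgt : ∃ q ∈ F, t < inner ℝ q u)
    (hne : ∀ x ∈ F, inner ℝ x u ≠ t) :
    ∃ e ∈ polygonSides (convexHull ℝ (F : Set Plane)), inner ℝ e.1 u < t ∧ t < inner ℝ e.2 u := by
  classical
  set f : Plane → ℝ := fun x => inner ℝ x u with hf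
  set l : Plane → ℝ := fun x => planeCross u x with hl
  -- Position on the level line `f = t` of its intersection with the segment `e`, measured by `l`,
  -- which increases to the left of `u`.
  set c : Plane × Plane → ℝ := fun e =>
    ((f e.2 - t) * l e.1 + (t - f e.1) * l e.2) / (f e.2 - f e.1) with hc
  set A : Finset (Plane × Plane) := (F ×ˢ F).filter fun e => f e.1 < t ∧ t < f e.2 with hA
  have memA : ∀ p q, (p, q) ∈ A ↔ (p ∈ F ∧ q ∈ F) ∧ f p < t ∧ t < f q := fun p q => by
    simp [hA]
  have hAne : A.Nonempty := by
    obtain ⟨p, hp, hp'⟩ := hlt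
    obtain ⟨q, hq, hq'⟩ := hgt
    exact ⟨(p, q), (memA p q).2 ⟨⟨hp, hq⟩, hp', hq'⟩⟩
  -- among the pairs with rightmost crossing point take the longest one
  obtain ⟨e₀, he₀, hmin₀⟩ := A.exists_min_image c hAne
  obtain ⟨⟨p, q⟩, he, hmax⟩ := (A.filter fun e => c e = c e₀).exists_max_image
    (fun e => f e.2 - f e.1) ⟨e₀, by simp [he₀]⟩
  rw [Finset.mem_filter] at he
  obtain ⟨heA, hce⟩ := he
  have hmin : ∀ e ∈ A, c (p, q) ≤ c e := fun e h => hce ▸ hmin₀ e h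
  have hmax' : ∀ e ∈ A, c e = c (p, q) → f e.2 - f e.1 ≤ f q - f p := fun e h h' =>
    hmax e (Finset.mem_filter.2 ⟨h, h'.trans hce⟩)
  obtain ⟨⟨hp, hq⟩, hpt, hqt⟩ := (memA p q).1 heA
  have hu : 0 < u 0 ^ 2 + u 1 ^ 2 := by
    by_contra hu
    have h0 : u 0 = 0 := by nlinarith [sq_nonneg (u 0), sq_nonneg (u 1)]
    have h1 : u 1 = 0 := by nlinarith [sq_nonneg (u 0), sq_nonneg (u 1)]
    have : f p = f q := by simp [hf, Plane.inner_eq, h0, h1]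
    linarith
  -- Replacing one endpoint by `x` moves the crossing point by a positive multiple of the cross
  -- product. Minimality of `c` therefore puts all of `F` to the left of the line `pq`, and the
  -- maximal length puts the collinear points between `p` and `q`.
  have id1 : ∀ x, f x < t → c (x, q) - c (p, q)
      = (f q - t) * ((u 0 ^ 2 + u 1 ^ 2) * planeCross (q - p) (x - p))
        / ((f q - f x) * (f q - f p)) := by
    intro x hx
    have d1 : f q - f x ≠ 0 := by linarith
    have d2 : f q - f p ≠ 0 := by linarith
    simp only [hc]
    rw [div_sub_div _ _ d1 d2]
    congr 1
    simp only [hf, hl, planeCross, Plane.inner_eq, PiLp.sub_apply]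
    ring
  have id2 : ∀ x, t < f x → c (p, x) - c (p, q)
      = (t - f p) * ((u 0 ^ 2 + u 1 ^ 2) * planeCross (q - p) (x - p))
        / ((f x - f p) * (f q - f p)) := by
    intro x hx
    have d1 : f x - f p ≠ 0 := by linarith
    have d2 : f q - f p ≠ 0 := by linarith
    simp only [hc]
    rw [div_sub_div _ _ d1 d2]
    congr 1
    simp only [hf, hl, planeCross, Plane.inner_eq, PiLp.sub_apply]
    ring
  have hF : ∀ x ∈ F, 0 < planeCross (q - p) (x - p) ∨
      (planeCross (q - p) (x - p) = 0 ∧ f p ≤ f x ∧ f x ≤ f q) := by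
    intro x hx
    rcases lt_or_gt_of_ne (hne x hx) with hxt | hxt
    · have hxt : f x < t := hxt
      have hm : (x, q) ∈ A := (memA x q).2 ⟨⟨hx, hq⟩, hxt, hqt⟩
      have h0 : 0 ≤ c (x, q) - c (p, q) := sub_nonneg.2 (hmin _ hm)
      rw [id1 x hxt] at h0
      have hden : 0 < (f q - f x) * (f q - f p) := mul_pos (by linarith) (by linarith)
      have h1 : 0 ≤ planeCross (q - p) (x - p) := by
        by_contra hneg
        push Not at hneg
        have : (f q - t) * ((u 0 ^ 2 + u 1 ^ 2) * planeCross (q - p) (x - p)) < 0 :=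
          mul_neg_of_pos_of_neg (by linarith) (mul_neg_of_pos_of_neg hu hneg)
        exact absurd h0 (not_le.2 (div_neg_of_neg_of_pos this hden))
      rcases h1.lt_or_eq with h1 | h1
      · exact Or.inl h1
      · refine Or.inr ⟨h1.symm, ?_, by linarith⟩
        have := hmax' _ hm (sub_eq_zero.1 (by rw [id1 x hxt, ← h1]; simp))
        simp only at this
        linarith
    · have hxt : t < f x := hxt
      have hm : (p, x) ∈ A := (memA p x).2 ⟨⟨hp, hx⟩, hpt, hxt⟩
      have h0 : 0 ≤ c (p, x) - c (p, q) := sub_nonneg.2 (hmin _ hm)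
      rw [id2 x hxt] at h0
      have hden : 0 < (f x - f p) * (f q - f p) := mul_pos (by linarith) (by linarith)
      have h1 : 0 ≤ planeCross (q - p) (x - p) := by
        by_contra hneg
        push Not at hneg
        have : (t - f p) * ((u 0 ^ 2 + u 1 ^ 2) * planeCross (q - p) (x - p)) < 0 :=
          mul_neg_of_pos_of_neg (by linarith) (mul_neg_of_pos_of_neg hu hneg)
        exact absurd h0 (not_le.2 (div_neg_of_neg_of_pos this hden))
      rcases h1.lt_or_eq with h1 | h1
      · exact Or.inl h1
      · refine Or.inr ⟨h1.symm, by linarith, ?_⟩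
        have := hmax' _ hm (sub_eq_zero.1 (by rw [id2 x hxt, ← h1]; simp))
        simp only at this
        linarith
  -- An open half-plane together with a segment of its boundary line is convex, so what holds on `F`
  -- passes to the hull.
  have hconv : Convex ℝ {x : Plane | 0 < planeCross (q - p) (x - p) ∨
      (planeCross (q - p) (x - p) = 0 ∧ f p ≤ f x ∧ f x ≤ f q)} := by
    rw [convex_iff_forall_pos]
    intro x hx y hy a b ha hb hab
    have e1 : planeCross (q - p) (a • x + b • y - p)
        = a * planeCross (q - p) (x - p) + b * planeCross (q - p) (y - p) := by
      have hb' : b = 1 - a := by linarith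
      subst hb'
      simp only [planeCross, PiLp.sub_apply, PiLp.add_apply, PiLp.smul_apply, smul_eq_mul]
      ring
    have e2 : f (a • x + b • y) = a * f x + b * f y := by
      simp only [hf, inner_add_left, real_inner_smul_left]
    simp only [Set.mem_ofPred_eq] at hx hy ⊢
    rw [e1, e2]
    rcases hx with hx | ⟨hx, hx1, hx2⟩
    · left
      rcases hy with hy | ⟨hy, -, -⟩
      · exact add_pos (mul_pos ha hx) (mul_pos hb hy)
      · rw [hy]; simpa using mul_pos ha hx
    · rcases hy with hy | ⟨hy, hy1, hy2⟩
      · left; rw [hx]; simpa using mul_pos hb hy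
      · right
        have hb' : b = 1 - a := by linarith
        subst hb'
        refine ⟨by rw [hx, hy]; ring, by nlinarith, by nlinarith⟩
  have hK := convexHull_min (s := (F : Set Plane)) (fun x hx => hF x hx) hconv
  refine ⟨(p, q), ⟨subset_convexHull ℝ _ hp, subset_convexHull ℝ _ hq, ?_, fun x hx => ?_,
    fun x hx hx0 => ?_⟩, hpt, hqt⟩
  · rintro (h : p = q)
    rw [h] at hpt
    linarith
  · rcases hK hx with h | ⟨h, -, -⟩
    · exact h.le
    · exact h.ge
  · rcases hK hx with h | ⟨-, h1, h2⟩
    · exact absurd hx0 h.ne'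
    simp only at hx0 ⊢
    have hd : 0 < f q - f p := by linarith
    rw [segment_eq_image']
    refine ⟨(f x - f p) / (f q - f p), ⟨div_nonneg (by linarith) hd.le,
      (div_le_one hd).2 (by linarith)⟩, ?_⟩
    have hr := div_mul_cancel₀ (f x - f p) hd.ne'
    generalize (f x - f p) / (f q - f p) = r at hr
    rw [Plane.ext_iff]
    simp only [PiLp.sub_apply, PiLp.add_apply, PiLp.smul_apply, smul_eq_mul]
    simp only [planeCross, PiLp.sub_apply] at hx0
    refine ⟨mul_right_cancel₀ hd.ne' ?_, mul_right_cancel₀ hd.ne' ?_⟩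
    · simp only [hf, Plane.inner_eq] at hr ⊢
      linear_combination (q 0 - p 0) * hr + u 1 * hx0
    · simp only [hf, Plane.inner_eq] at hr ⊢
      linear_combination (q 1 - p 1) * hr - u 0 * hx0

/-! ### Range of a linear functional on a polygon. -/

/-- The difference between the largest and the smallest value of `f` on a finite set. -/
noncomputable def spread {ι : Type*} (s : Finset ι) (hs : s.Nonempty) (f : ι → ℝ) : ℝ :=
  s.sup' hs f - s.inf' hs f

lemma sub_le_spread {ι : Type*} {s : Finset ι} (hs : s.Nonempty) (f : ι → ℝ) {i j : ι}
    (hi : i ∈ s) (hj : j ∈ s) : f i - f j ≤ spread s hs f :=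
  sub_le_sub (s.le_sup' f hi) (s.inf'_le f hj)

lemma exists_spread_eq {ι : Type*} {s : Finset ι} (hs : s.Nonempty) (f : ι → ℝ) :
    ∃ i ∈ s, ∃ j ∈ s, spread s hs f = f i - f j := by
  obtain ⟨i, hi, hi'⟩ := s.exists_mem_eq_sup' hs f
  obtain ⟨j, hj, hj'⟩ := s.exists_mem_eq_inf' hs f
  exact ⟨i, hi, j, hj, by rw [spread, hi', hj']⟩

lemma spread_nonneg {ι : Type*} {s : Finset ι} (hs : s.Nonempty) (f : ι → ℝ) :
    0 ≤ spread s hs f := by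
  obtain ⟨i, hi⟩ := hs
  simpa using sub_le_spread ⟨i, hi⟩ f hi hi

/-- The total variation of a linear functional along the boundary of a polygon is twice the length
of its range: the functional goes up once and down once. -/
lemma sum_polygonSides_posPart (F : Finset Plane) (hF : F.Nonempty) (u : Plane) :
    ∑ e ∈ (finite_polygonSides_convexHull F.finite_toSet).toFinset,
      max (inner ℝ (e.2 - e.1) u) 0 = spread F hF (fun x => inner ℝ x u) := by
  set S := (finite_polygonSides_convexHull F.finite_toSet).toFinset with hS
  have memS : ∀ e, e ∈ S ↔ e ∈ polygonSides (convexHull ℝ (F : Set Plane)) := fun e => by simp [hS]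
  set f : Plane → ℝ := fun x => inner ℝ x u with hf
  -- A side along which `f` does not increase gives an empty interval, so lengths of intervals are
  -- exactly the positive parts.
  have hdisj : (S : Set (Plane × Plane)).PairwiseDisjoint fun e => Set.Ioo (f e.1) (f e.2) := by
    intro e he e' he' hne
    rw [Function.onFun, Set.disjoint_left]
    intro t ht ht'
    exact hne (polygonSides_eq_of_crossing ((memS e).1 he) ((memS e').1 he') ht ht')
  have hvol := measure_biUnion_finset (μ := volume) hdisj fun e _ => measurableSet_Ioo
  have hunion : volume (⋃ e ∈ S, Set.Ioo (f e.1) (f e.2))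
      = volume (Set.Ioo (F.inf' hF f) (F.sup' hF f)) := by
    refine le_antisymm (measure_mono ?_) ?_
    · refine Set.iUnion₂_subset fun e he => ?_
      obtain ⟨h1, h2⟩ := mem_of_mem_polygonSides_convexHull ((memS e).1 he)
      exact Set.Ioo_subset_Ioo (F.inf'_le f h1) (F.le_sup' f h2)
    -- The levels of the points of `F` must be avoided to apply the crossing lemma; they form a
    -- finite set, hence a null set.
    · rw [← measure_sdiff_null (s := Set.Ioo (F.inf' hF f) (F.sup' hF f))
        (((F : Set Plane).toFinite.image f).measure_zero volume)]
      refine measure_mono ?_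
      rintro t ⟨⟨h1, h2⟩, h3⟩
      obtain ⟨p, hp, hp'⟩ := F.exists_mem_eq_inf' hF f
      obtain ⟨q, hq, hq'⟩ := F.exists_mem_eq_sup' hF f
      obtain ⟨e, he, het⟩ := exists_polygonSides_crossing F u t
        ⟨p, hp, hp'.symm.trans_lt h1⟩ ⟨q, hq, h2.trans_eq hq'⟩ fun x hx hxt => h3 ⟨x, hx, hxt⟩
      exact Set.mem_iUnion₂.2 ⟨e, (memS e).2 he, het⟩
  rw [hunion] at hvol
  simp only [Real.volume_Ioo] at hvol
  have h1 : ∀ e : Plane × Plane, ENNReal.ofReal (f e.2 - f e.1)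
      = ENNReal.ofReal (max (inner ℝ (e.2 - e.1) u) 0) := fun e => by
    rw [inner_sub_left, ENNReal.ofReal_max]; simp [hf]
  simp only [h1] at hvol
  rw [← ENNReal.ofReal_sum_of_nonneg fun e _ => le_max_right _ _] at hvol
  exact ((ENNReal.ofReal_eq_ofReal_iff (spread_nonneg hF f)
    (Finset.sum_nonneg fun e _ => le_max_right _ _)).1 hvol).symm

/-! ### Integrals over directions and Cauchy's formula. -/

lemma Real.measurable_sign : Measurable Real.sign := by
  unfold Real.sign
  exact Measurable.ite measurableSet_Iio measurable_const
    (Measurable.ite measurableSet_Ioi measurable_const measurable_const)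

lemma Real.sign_mul_self_eq_abs (x : ℝ) : Real.sign x * x = |x| := by
  rcases lt_trichotomy x 0 with h | h | h
  · rw [Real.sign_of_neg h, abs_of_neg h]; ring
  · simp [h]
  · rw [Real.sign_of_pos h, abs_of_pos h]; ring

lemma Real.abs_sign_le_one (x : ℝ) : |Real.sign x| ≤ 1 := by
  rcases Real.sign_apply_eq x with h | h | h <;> simp [h]

lemma Real.sign_mul_le_abs (x y : ℝ) : Real.sign x * y ≤ |y| :=
  (le_abs_self _).trans (by
    rw [abs_mul]; exact mul_le_of_le_one_left (abs_nonneg y) (Real.abs_sign_le_one x))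

/-- After the shift by `α`, the period from -π/2 to 3π/2 splits at π/2 into two intervals on each of
which the sign is constant. -/
lemma integral_sign_cos_mul_cos (α β : ℝ) :
    ∫ θ in (0 : ℝ)..2 * Real.pi, Real.sign (Real.cos (θ - α)) * Real.cos (θ - β)
      = 4 * Real.cos (α - β) := by
  set f : ℝ → ℝ := fun φ => Real.sign (Real.cos φ) * Real.cos (φ + (α - β)) with hf
  have hper : Function.Periodic f (2 * Real.pi) := fun x => by
    simp only [hf, Real.cos_add_two_pi]
    rw [show x + 2 * Real.pi + (α - β) = x + (α - β) + 2 * Real.pi by ring, Real.cos_add_two_pi]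
  have e1 : ∫ θ in (0 : ℝ)..2 * Real.pi, Real.sign (Real.cos (θ - α)) * Real.cos (θ - β)
      = ∫ φ in (0 - α)..(2 * Real.pi - α), f φ := by
    rw [← intervalIntegral.integral_comp_sub_right]
    refine intervalIntegral.integral_congr fun θ _ => ?_
    simp only [hf]
    ring_nf
  have e2 : ∫ φ in (0 - α)..(2 * Real.pi - α), f φ
      = ∫ φ in (-(Real.pi / 2))..(-(Real.pi / 2) + 2 * Real.pi), f φ := by
    rw [← hper.intervalIntegral_add_eq (0 - α)]
    ring_nf
  have hπ := Real.pi_pos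
  have c1 : Set.EqOn (fun φ => Real.cos (φ + (α - β))) f
      (Set.uIoo (-(Real.pi / 2)) (Real.pi / 2)) := by
    rw [Set.uIoo_of_le (by linarith)]
    intro φ hφ
    simp only [hf]
    rw [Real.sign_of_pos (Real.cos_pos_of_mem_Ioo hφ), one_mul]
  have c2 : Set.EqOn (fun φ => -Real.cos (φ + (α - β))) f
      (Set.uIoo (Real.pi / 2) (-(Real.pi / 2) + 2 * Real.pi)) := by
    rw [Set.uIoo_of_le (by linarith)]
    intro φ hφ
    simp only [hf]
    rw [Real.sign_of_neg (Real.cos_neg_of_pi_div_two_lt_of_lt hφ.1 (by linarith [hφ.2])), neg_one_mul]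
  have i1 : IntervalIntegrable f volume (-(Real.pi / 2)) (Real.pi / 2) :=
    IntervalIntegrable.congr_uIoo (Continuous.intervalIntegrable (by fun_prop) _ _) c1
  have i2 : IntervalIntegrable f volume (Real.pi / 2) (-(Real.pi / 2) + 2 * Real.pi) :=
    IntervalIntegrable.congr_uIoo (Continuous.intervalIntegrable (by fun_prop) _ _) c2
  rw [e1, e2, ← intervalIntegral.integral_add_adjacent_intervals i1 i2,
    ← intervalIntegral.integral_congr_uIoo c1, ← intervalIntegral.integral_congr_uIoo c2,
    intervalIntegral.integral_neg, intervalIntegral.integral_comp_add_right (fun x => Real.cos x),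
    intervalIntegral.integral_comp_add_right (fun x => Real.cos x), integral_cos, integral_cos]
  rw [show -(Real.pi / 2) + 2 * Real.pi + (α - β) = (α - β) - Real.pi / 2 + 2 * Real.pi by ring,
    Real.sin_add_two_pi, show Real.pi / 2 + (α - β) = (α - β) + Real.pi / 2 by ring,
    show -(Real.pi / 2) + (α - β) = (α - β) - Real.pi / 2 by ring,
    Real.sin_add_pi_div_two, Real.sin_sub_pi_div_two]
  ring

/-- Lebesgue measure on `(0, 2π]`, the measure of directions in the plane. -/
noncomputable def angleMeasure : Measure ℝ := volume.restrict (Set.Ioc 0 (2 * Real.pi))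

instance : IsFiniteMeasure angleMeasure := by
  unfold angleMeasure; infer_instance

lemma integral_angleMeasure (f : ℝ → ℝ) :
    ∫ θ, f θ ∂angleMeasure = ∫ θ in (0 : ℝ)..2 * Real.pi, f θ := by
  rw [intervalIntegral.integral_of_le Real.two_pi_pos.le, angleMeasure]

lemma Plane.exists_polar (v : Plane) : ∃ α : ℝ, v = ‖v‖ • unitVec α := by
  refine ⟨Complex.arg (⟨v 0, v 1⟩ : ℂ), ?_⟩
  have hn : ‖v‖ = ‖(⟨v 0, v 1⟩ : ℂ)‖ := by
    rw [EuclideanSpace.norm_eq, Complex.norm_eq_sqrt_sq_add_sq]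
    simp [Fin.sum_univ_two]
  rw [hn, Plane.ext_iff]
  simp only [unitVec, PiLp.smul_apply, smul_eq_mul, Matrix.cons_val_zero, Matrix.cons_val_one]
  exact ⟨(Complex.norm_mul_cos_arg ⟨v 0, v 1⟩).symm, (Complex.norm_mul_sin_arg ⟨v 0, v 1⟩).symm⟩

lemma inner_smul_unitVec (r α θ : ℝ) :
    inner ℝ (r • unitVec α) (unitVec θ) = r * Real.cos (θ - α) := by
  rw [real_inner_smul_left, Plane.inner_eq, Real.cos_sub]
  simp only [unitVec, Matrix.cons_val_zero, Matrix.cons_val_one]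
  ring

lemma norm_unitVec (θ : ℝ) : ‖unitVec θ‖ = 1 := by
  rw [EuclideanSpace.norm_eq]
  simp [unitVec, Fin.sum_univ_two]

lemma Real.sign_pos_mul {r : ℝ} (hr : 0 < r) (x : ℝ) : Real.sign (r * x) = Real.sign x := by
  rcases lt_trichotomy x 0 with h | h | h
  · rw [Real.sign_of_neg h, Real.sign_of_neg (mul_neg_of_pos_of_neg hr h)]
  · simp [h]
  · rw [Real.sign_of_pos h, Real.sign_of_pos (mul_pos hr h)]

/-- Polar coordinates reduce this to cosines. It is the identity that converts a sign frozen at the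
drift `ν` into the unit vector along `ν`. -/
lemma integral_sign_inner_mul_inner {ν : Plane} (hν : ν ≠ 0) (v : Plane) :
    ∫ θ, Real.sign (inner ℝ ν (unitVec θ)) * inner ℝ v (unitVec θ) ∂angleMeasure
      = 4 * inner ℝ v (‖ν‖⁻¹ • ν) := by
  obtain ⟨α, hα⟩ := ν.exists_polar
  obtain ⟨β, hβ⟩ := v.exists_polar
  have hν' : 0 < ‖ν‖ := norm_pos_iff.2 hν
  generalize ‖ν‖ = r at hα hν'
  generalize ‖v‖ = s at hβ
  subst hα hβ
  rw [integral_angleMeasure, smul_smul, inv_mul_cancel₀ hν'.ne', one_smul, inner_smul_unitVec]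
  simp only [inner_smul_unitVec, Real.sign_pos_mul hν', mul_left_comm _ s]
  rw [intervalIntegral.integral_const_mul, integral_sign_cos_mul_cos]

lemma integral_inner_unitVec (v : Plane) :
    ∫ θ, inner ℝ v (unitVec θ) ∂angleMeasure = 0 := by
  obtain ⟨β, hβ⟩ := v.exists_polar
  rw [hβ, integral_angleMeasure]
  simp only [inner_smul_unitVec]
  rw [intervalIntegral.integral_const_mul,
    intervalIntegral.integral_comp_sub_right (fun x => Real.cos x), integral_cos]
  simp [Real.sin_two_pi_sub]

lemma continuous_unitVec : Continuous unitVec := by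
  unfold unitVec
  fun_prop

lemma integrable_sign_inner_mul_inner (ν v : Plane) :
    Integrable (fun θ => Real.sign (inner ℝ ν (unitVec θ)) * inner ℝ v (unitVec θ))
      angleMeasure := by
  have h := continuous_unitVec.measurable
  refine Integrable.of_bound (C := ‖v‖) ?_ (ae_of_all _ fun θ => ?_)
  · refine (Measurable.mul (Real.measurable_sign.comp ?_) ?_).aestronglyMeasurable
    · exact measurable_const.inner h
    · exact measurable_const.inner h
  · rw [Real.norm_eq_abs, abs_mul]
    refine (mul_le_of_le_one_left (abs_nonneg _) (Real.abs_sign_le_one _)).trans ?_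
    simpa [norm_unitVec] using abs_real_inner_le_norm v (unitVec θ)

lemma integrable_inner_unitVec (v : Plane) :
    Integrable (fun θ => inner ℝ v (unitVec θ)) angleMeasure := by
  refine Integrable.of_bound (C := ‖v‖)
    (measurable_const.inner continuous_unitVec.measurable).aestronglyMeasurable
    (ae_of_all _ fun θ => ?_)
  simpa [norm_unitVec] using abs_real_inner_le_norm v (unitVec θ)

lemma integral_posPart_inner_unitVec (v : Plane) :
    ∫ θ, max (inner ℝ v (unitVec θ)) 0 ∂angleMeasure = 2 * ‖v‖ := by
  rcases eq_or_ne v 0 with rfl | hv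
  · simp
  have h : ∀ θ, max (inner ℝ v (unitVec θ)) 0 = 2⁻¹ * (inner ℝ v (unitVec θ)
      + Real.sign (inner ℝ v (unitVec θ)) * inner ℝ v (unitVec θ)) := fun θ => by
    rw [Real.sign_mul_self_eq_abs]
    rcases le_total (inner ℝ v (unitVec θ)) 0 with h | h
    · rw [max_eq_right h, abs_of_nonpos h]; ring
    · rw [max_eq_left h, abs_of_nonneg h]; ring
  simp only [h]
  rw [integral_const_mul, integral_add (integrable_inner_unitVec v)
    (integrable_sign_inner_mul_inner v v), integral_inner_unitVec,
    integral_sign_inner_mul_inner hv, real_inner_smul_right, real_inner_self_eq_norm_sq]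
  have : ‖v‖ ≠ 0 := norm_ne_zero_iff.2 hv
  field_simp
  ring

/-- **Cauchy's formula**: the perimeter of a polygon is the integral of its widths. -/
theorem polygonPerimeter_convexHull (F : Finset Plane) (hF : F.Nonempty) :
    polygonPerimeter (convexHull ℝ (F : Set Plane))
      = 2⁻¹ * ∫ θ, spread F hF (fun x => inner ℝ x (unitVec θ)) ∂angleMeasure := by
  have hfin := finite_polygonSides_convexHull F.finite_toSet
  rw [polygonPerimeter, finsum_mem_eq_finite_toFinset_sum _ hfin]
  simp only [← sum_polygonSides_posPart]
  rw [integral_finsetSum]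
  · simp only [integral_posPart_inner_unitVec]
    rw [← Finset.mul_sum, inv_mul_cancel_left₀ two_ne_zero]
    exact Finset.sum_congr rfl fun e _ => dist_eq_norm' _ _
  · exact fun e _ => (integrable_inner_unitVec _).pos_part

/-! ### Maximal inequality and exponential moments for sums on the line. -/

/-- The running maximum of a sequence. -/
noncomputable def runMax (s : ℕ → ℝ) : ℕ → ℝ
  | 0 => s 0
  | n + 1 => max (runMax s n) (s (n + 1))

lemma le_runMax (s : ℕ → ℝ) {j n : ℕ} (h : j ≤ n) : s j ≤ runMax s n := by
  induction n with
  | zero => rw [Nat.le_zero.1 h]; rfl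
  | succ n ih =>
    rcases h.lt_or_eq with h | h
    · exact (ih (Nat.lt_succ_iff.1 h)).trans (le_max_left _ _)
    · rw [h]; exact le_max_right _ _

/-- Pathwise form of Doob's `L²` maximal inequality. -/
lemma runMax_sq_le (s : ℕ → ℝ) (h0 : s 0 = 0) (n : ℕ) :
    runMax s n ^ 2
      ≤ 4 * s n ^ 2 - 4 * ∑ k ∈ Finset.range n, runMax s k * (s (k + 1) - s k) := by
  -- Discrete integration by parts: when the maximum increases it equals the path, and the induction
  -- step reduces to a square being nonnegative.
  have key : ∑ k ∈ Finset.range n, runMax s k * (s (k + 1) - s k)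
      ≤ runMax s n * s n - runMax s n ^ 2 / 2 := by
    induction n with
    | zero => simp [runMax, h0]
    | succ n ih =>
      rw [Finset.sum_range_succ]
      simp only [runMax]
      rcases le_total (runMax s n) (s (n + 1)) with h | h
      · rw [max_eq_right h]
        nlinarith [sq_nonneg (s (n + 1) - runMax s n)]
      · rw [max_eq_left h]
        nlinarith
  nlinarith [sq_nonneg (2 * s n - runMax s n)]

lemma measurable_runMax {Ω : Type*} {m : MeasurableSpace Ω} {S : ℕ → Ω → ℝ} {n : ℕ}
    (hS : ∀ j ≤ n, Measurable (S j)) :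
    Measurable (fun ω => runMax (fun j => S j ω) n) := by
  induction n with
  | zero => exact hS 0 le_rfl
  | succ n ih => exact (ih fun j hj => hS j (by omega)).max (hS (n + 1) le_rfl)

section OneDim

variable {Ω : Type*} [mΩ : MeasurableSpace Ω] {P : Measure Ω}

lemma memLp_runMax {S : ℕ → Ω → ℝ} (hS : ∀ j, MemLp (S j) 2 P) (n : ℕ) :
    MemLp (fun ω => runMax (fun j => S j ω) n) 2 P := by
  induction n with
  | zero => exact hS 0
  | succ n ih => exact ih.sup (hS (n + 1))

/-- Cutting off at a high level; the remainder tends to zero in L² by dominated convergence. -/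
lemma exists_truncation {X : Ω → ℝ} (hX : MemLp X 2 P) {ε : ℝ} (hε : 0 < ε) :
    ∃ (φ : ℝ → ℝ) (K : ℝ), Measurable φ ∧ (∀ x, |φ x| ≤ K) ∧
      ∫ ω, (X ω - φ (X ω)) ^ 2 ∂P < ε := by
  set φ : ℕ → ℝ → ℝ := fun K x => if |x| ≤ K then x else 0 with hφ
  have hmeas : ∀ K, Measurable (φ K) := fun K =>
    Measurable.ite (measurableSet_le continuous_abs.measurable measurable_const) measurable_id
      measurable_const
  have hlim : Tendsto (fun K => ∫ ω, (X ω - φ K (X ω)) ^ 2 ∂P) atTop (𝓝 (∫ _, (0 : ℝ) ∂P)) := by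
    refine tendsto_integral_of_dominated_convergence (fun ω => X ω ^ 2) (fun K => ?_)
      hX.integrable_sq (fun K => ae_of_all _ fun ω => ?_) (ae_of_all _ fun ω => ?_)
    · exact ((hX.1.aemeasurable.sub ((hmeas K).comp_aemeasurable hX.1.aemeasurable)).pow_const
        2).aestronglyMeasurable
    · simp only [hφ]
      split_ifs
      · simp; positivity
      · simp
    · refine tendsto_const_nhds.congr' ?_
      filter_upwards [eventually_ge_atTop ⌈|X ω|⌉₊] with K hK
      have : |X ω| ≤ K := Nat.ceil_le.1 hK
      simp [hφ, this]
  rw [integral_zero] at hlim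
  obtain ⟨K, hK⟩ := ((tendsto_order.1 hlim).2 ε hε).exists
  refine ⟨φ K, K, hmeas K, fun x => ?_, hK⟩
  simp only [hφ]
  split_ifs with h
  · exact h
  · simp

variable {ξ : ℕ → Ω → ℝ}

lemma memLp_partialSum (hL2 : ∀ i, MemLp (ξ i) 2 P) (s : Finset ℕ) :
    MemLp (fun ω => ∑ i ∈ s, ξ i ω) 2 P :=
  memLp_finsetSum _ fun i _ => hL2 i

variable [IsProbabilityMeasure P]

lemma integral_partialSum_sq (hm : ∀ i, Measurable (ξ i)) (hind : iIndepFun ξ P)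
    (hL2 : ∀ i, MemLp (ξ i) 2 P) (h0 : ∀ i, ∫ ω, ξ i ω ∂P = 0) {v : ℝ}
    (hv : ∀ i, ∫ ω, ξ i ω ^ 2 ∂P = v) (n : ℕ) :
    ∫ ω, (∑ i ∈ Finset.range n, ξ i ω) ^ 2 ∂P = n * v := by
  have h1 : ∫ ω, (∑ i ∈ Finset.range n, ξ i) ω ∂P = 0 := by
    simp only [Finset.sum_apply]
    rw [integral_finsetSum _ fun i _ => (hL2 i).integrable (by norm_num)]
    simp [h0]
  have h2 := variance_of_integral_eq_zero (X := ∑ i ∈ Finset.range n, ξ i)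
    (Finset.aemeasurable_sum _ fun i _ => (hm i).aemeasurable) h1
  rw [IndepFun.variance_sum (fun i _ => hL2 i) fun i _ j _ hij => hind.indepFun hij] at h2
  simp only [Finset.sum_apply] at h2
  rw [← h2, Finset.sum_congr rfl fun i _ =>
    (variance_of_integral_eq_zero (hm i).aemeasurable (h0 i)).trans (hv i)]
  simp

/-- Doob's maximal inequality for sums of independent centered variables. -/
lemma integral_runMax_sq_le (hm : ∀ i, Measurable (ξ i)) (hind : iIndepFun ξ P)
    (hL2 : ∀ i, MemLp (ξ i) 2 P) (h0 : ∀ i, ∫ ω, ξ i ω ∂P = 0) {v : ℝ}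
    (hv : ∀ i, ∫ ω, ξ i ω ^ 2 ∂P = v) (n : ℕ) :
    ∫ ω, runMax (fun j => ∑ i ∈ Finset.range j, ξ i ω) n ^ 2 ∂P ≤ 4 * (n * v) := by
  have hS : ∀ j, MemLp (fun ω => ∑ i ∈ Finset.range j, ξ i ω) 2 P := fun j =>
    memLp_partialSum hL2 _
  have hM := fun k => memLp_runMax hS k
  have hMξ : ∀ k, Integrable (fun ω => runMax (fun j => ∑ i ∈ Finset.range j, ξ i ω) k * ξ k ω) P :=
    fun k => (hM k).integrable_mul (hL2 k)
  -- The maximum up to time `k` involves only the steps with index below `k`, so it is independent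
  -- of the centered step `ξ k`.
  have hzero : ∀ k, ∫ ω, runMax (fun j => ∑ i ∈ Finset.range j, ξ i ω) k * ξ k ω ∂P = 0 := by
    intro k
    have hI := indep_iSup_of_disjoint (fun i => (hm i).comap_le) hind.iIndep
      (S := Set.Iio k) (T := {k}) (by simp)
    have hI' : IndepFun (fun ω => runMax (fun j => ∑ i ∈ Finset.range j, ξ i ω) k) (ξ k) P := by
      rw [IndepFun_iff_Indep]
      refine indep_of_indep_of_le_left (indep_of_indep_of_le_right hI ?_) ?_
      · simp
      · rw [← measurable_iff_comap_le]
        refine measurable_runMax fun j hj => Finset.measurable_sum _ fun i hi => ?_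
        rw [measurable_iff_comap_le]
        exact le_iSup₂ (f := fun i (_ : i ∈ Set.Iio k) => MeasurableSpace.comap (ξ i) _) i
          (lt_of_lt_of_le (Finset.mem_range.1 hi) hj)
    rw [hI'.integral_fun_mul_eq_mul_integral (hM k).1 (hL2 k).1, h0, mul_zero]
  have hle : ∀ ω, runMax (fun j => ∑ i ∈ Finset.range j, ξ i ω) n ^ 2
      ≤ 4 * (∑ i ∈ Finset.range n, ξ i ω) ^ 2
        - 4 * ∑ k ∈ Finset.range n, runMax (fun j => ∑ i ∈ Finset.range j, ξ i ω) k * ξ k ω := by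
    intro ω
    have := runMax_sq_le (fun j => ∑ i ∈ Finset.range j, ξ i ω) (by simp) n
    simpa [Finset.sum_range_succ] using this
  have hsumI := integrable_finsetSum (Finset.range n) fun k _ => hMξ k
  refine (integral_mono (hM n).integrable_sq
    (((hS n).integrable_sq.const_mul 4).sub (hsumI.const_mul 4)) hle).trans (le_of_eq ?_)
  simp only [Pi.sub_apply]
  rw [integral_sub ((hS n).integrable_sq.const_mul 4) (hsumI.const_mul 4), integral_const_mul,
    integral_const_mul, integral_partialSum_sq hm hind hL2 h0 hv,
    integral_finsetSum _ fun k _ => hMξ k]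
  simp [hzero]

/-- The squares of the partial sums up to time `n` are dominated by an integrable function whose
integral grows linearly. -/
lemma exists_dominating_partialSum_sq (hm : ∀ i, Measurable (ξ i)) (hind : iIndepFun ξ P)
    (hL2 : ∀ i, MemLp (ξ i) 2 P) (h0 : ∀ i, ∫ ω, ξ i ω ∂P = 0) {v : ℝ}
    (hv : ∀ i, ∫ ω, ξ i ω ^ 2 ∂P = v) (n : ℕ) :
    ∃ R : Ω → ℝ, Integrable R P ∧ ∫ ω, R ω ∂P ≤ 8 * (n * v) ∧
      ∀ ω, ∀ j ≤ n, (∑ i ∈ Finset.range j, ξ i ω) ^ 2 ≤ R ω := by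
  -- `runMax` controls the sums from above only; the walk with steps `-ξ i` controls them from
  -- below, whence 8 = 4 + 4.
  have hm' : ∀ i, Measurable (fun ω => -ξ i ω) := fun i => (hm i).neg
  have hind' : iIndepFun (fun i ω => -ξ i ω) P := hind.comp (fun _ x => -x) fun _ => measurable_neg
  have hL2' : ∀ i, MemLp (fun ω => -ξ i ω) 2 P := fun i => (hL2 i).neg
  have i1 := (memLp_runMax (fun j => memLp_partialSum hL2 (Finset.range j)) n).integrable_sq
  have i2 := (memLp_runMax (fun j => memLp_partialSum hL2' (Finset.range j)) n).integrable_sq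
  refine ⟨fun ω => runMax (fun j => ∑ i ∈ Finset.range j, ξ i ω) n ^ 2
    + runMax (fun j => ∑ i ∈ Finset.range j, -ξ i ω) n ^ 2, i1.add i2, ?_, fun ω j hj => ?_⟩
  · rw [integral_add i1 i2]
    have l1 := integral_runMax_sq_le hm hind hL2 h0 hv n
    have l2 := integral_runMax_sq_le hm' hind' hL2' (fun i => by rw [integral_neg, h0, neg_zero])
      (v := v) (fun i => by simpa using hv i) n
    linarith
  · have l1 := le_runMax (fun j => ∑ i ∈ Finset.range j, ξ i ω) hj
    have l2 := le_runMax (fun j => ∑ i ∈ Finset.range j, -ξ i ω) hj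
    simp only [Finset.sum_neg_distrib] at l2 ⊢
    rcases le_total 0 (∑ i ∈ Finset.range j, ξ i ω) with h | h
    · nlinarith [sq_nonneg (runMax (fun j => -∑ i ∈ Finset.range j, ξ i ω) n)]
    · nlinarith [sq_nonneg (runMax (fun j => ∑ i ∈ Finset.range j, ξ i ω) n)]

/-- Sums of independent bounded variables with a common negative mean have an exponentially
decaying exponential moment. -/
lemma exists_exp_moment_le {β : ℕ → Ω → ℝ} (hm : ∀ i, Measurable (β i)) (hind : iIndepFun β P)
    {c : ℝ} (hc : ∀ i ω, |β i ω| ≤ c) (h0 : ∀ i, ∫ ω, β i ω ∂P = 0) {a : ℝ} (ha : 0 < a) :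
    ∃ l r : ℝ, 0 < l ∧ 0 ≤ r ∧ r < 1 ∧ ∀ s : Finset ℕ,
      Integrable (fun ω => Real.exp (l * ∑ i ∈ s, (-a - β i ω))) P ∧
      ∫ ω, Real.exp (l * ∑ i ∈ s, (-a - β i ω)) ∂P ≤ r ^ s.card := by
  obtain ⟨ω₀⟩ : Nonempty Ω := nonempty_of_isProbabilityMeasure P
  have hc0 : 0 ≤ c := (abs_nonneg _).trans (hc 0 ω₀)
  -- Hoeffding's lemma bounds the exponent by `-a * t + C * t ^ 2 / 2`, which is least at `t = a /
  -- C`, with value `-(a ^ 2 / (2 * C))`. The summand 1 keeps `C` positive when `c = 0`.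
  set C : ℝ := c ^ 2 + 1 with hC
  have hCpos : 0 < C := by positivity
  have hm' : ∀ i, Measurable (fun ω => -a - β i ω) := fun i => measurable_const.sub (hm i)
  have hind' : iIndepFun (fun i ω => -a - β i ω) P :=
    hind.comp (fun _ x => -a - x) fun _ => measurable_const.sub measurable_id
  have hint : ∀ (t : ℝ) i, Integrable (fun ω => Real.exp (t * (-a - β i ω))) P := fun t i =>
    integrable_exp_mul_of_mem_Icc (a := -a - c) (b := -a + c) (hm' i).aemeasurable
      (ae_of_all _ fun ω => ⟨by linarith [(abs_le.1 (hc i ω)).2], by linarith [(abs_le.1 (hc i ω)).1]⟩)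
  have hmgf : ∀ i, mgf (fun ω => -a - β i ω) P (a / C) ≤ Real.exp (-(a ^ 2 / (2 * C))) := by
    intro i
    have hsub := hasSubgaussianMGF_of_mem_Icc_of_integral_eq_zero (X := fun ω => -β i ω) (μ := P)
      (a := -c) (b := c) (hm i).neg.aemeasurable
      (ae_of_all _ fun ω => ⟨by linarith [(abs_le.1 (hc i ω)).2], by linarith [(abs_le.1 (hc i ω)).1]⟩)
      (by rw [integral_neg, h0, neg_zero])
    have h1 := hsub.mgf_le (a / C)
    have h2 : mgf (fun ω => -a - β i ω) P (a / C)
        = Real.exp (a / C * -a) * mgf (fun ω => -β i ω) P (a / C) := by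
      rw [← mgf_const_add]; rfl
    rw [h2]
    refine (mul_le_mul_of_nonneg_left h1 (Real.exp_pos _).le).trans ?_
    rw [← Real.exp_add, Real.exp_le_exp]
    have h3 : (((‖c - -c‖₊ / 2) ^ 2 : NNReal) : ℝ) = c ^ 2 := by
      push_cast
      rw [Real.norm_eq_abs, sub_neg_eq_add, abs_of_nonneg (by linarith)]
      ring
    rw [h3]
    have h4 : c ^ 2 * (a / C) ^ 2 / 2 ≤ C * (a / C) ^ 2 / 2 := by
      have : c ^ 2 ≤ C := by linarith
      gcongr
    have h5 : a / C * -a + C * (a / C) ^ 2 / 2 = -(a ^ 2 / (2 * C)) := by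
      field_simp
      ring
    linarith
  refine ⟨a / C, Real.exp (-(a ^ 2 / (2 * C))), by positivity, (Real.exp_pos _).le, ?_, fun s => ?_⟩
  · rw [Real.exp_lt_one_iff]
    have : 0 < a ^ 2 / (2 * C) := by positivity
    linarith
  · have e1 : ∀ ω, Real.exp (a / C * ∑ i ∈ s, (-a - β i ω))
        = Real.exp (a / C * (∑ i ∈ s, fun ω => -a - β i ω) ω) := fun ω => by
      rw [Finset.sum_apply]
    simp only [e1]
    refine ⟨hind'.integrable_exp_mul_sum hm' fun i _ => hint _ i, ?_⟩
    have h1 := hind'.mgf_sum (t := a / C) hm' s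
    rw [mgf] at h1
    rw [h1, ← Finset.prod_const]
    exact Finset.prod_le_prod (fun i _ => mgf_nonneg) fun i _ => hmgf i

end OneDim

/-! ### The excess of a walk on the line with drift. -/

lemma spread_neg {ι : Type*} {s : Finset ι} (hs : s.Nonempty) (f : ι → ℝ) :
    spread s hs (fun i => -f i) = spread s hs f := by
  apply le_antisymm
  · obtain ⟨i, hi, j, hj, h⟩ := exists_spread_eq hs fun i => -f i
    linarith [sub_le_spread hs f hj hi]
  · obtain ⟨i, hi, j, hj, h⟩ := exists_spread_eq hs f
    linarith [sub_le_spread hs (fun i => -f i) hj hi]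

lemma measurable_spread {ι α : Type*} [MeasurableSpace α] {s : Finset ι} (hs : s.Nonempty)
    {f : ι → α → ℝ} (hf : ∀ i ∈ s, Measurable (f i)) :
    Measurable fun x => spread s hs fun i => f i x := by
  have h1 := Finset.measurable_sup' hs hf
  have h2 : Measurable (s.inf' hs f) :=
    Finset.inf'_induction hs _ (fun _ hf _ hg => hf.inf hg) fun n hn => hf n hn
  convert! h1.sub h2 using 1
  ext x
  simp [spread, Finset.sup'_apply, Finset.inf'_apply]

/-- The range of the path `s 0, …, s n`, diminished by its final displacement in the direction of
the sign of `a`. -/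
noncomputable def excess (a : ℝ) (s : ℕ → ℝ) (n : ℕ) : ℝ :=
  spread (Finset.range (n + 1)) Finset.nonempty_range_add_one s - Real.sign a * s n

lemma abs_le_spread_range (s : ℕ → ℝ) (h0 : s 0 = 0) (n : ℕ) :
    |s n| ≤ spread (Finset.range (n + 1)) Finset.nonempty_range_add_one s := by
  have hs : (Finset.range (n + 1)).Nonempty := Finset.nonempty_range_add_one
  have h1 := sub_le_spread hs s (i := n) (j := 0) (by simp) (by simp)
  have h2 := sub_le_spread hs s (i := 0) (j := n) (by simp) (by simp)
  exact abs_le.2 ⟨by linarith, by linarith⟩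

lemma excess_nonneg (a : ℝ) (s : ℕ → ℝ) (h0 : s 0 = 0) (n : ℕ) : 0 ≤ excess a s n :=
  sub_nonneg.2 ((Real.sign_mul_le_abs a (s n)).trans (abs_le_spread_range s h0 n))

lemma excess_neg (a : ℝ) (s : ℕ → ℝ) (n : ℕ) :
    excess (-a) (fun j => -s j) n = excess a s n := by
  have : Real.sign (-a) = -Real.sign a := by
    rcases lt_trichotomy a 0 with h | h | h
    · rw [Real.sign_of_neg h, Real.sign_of_pos (by linarith), neg_neg]
    · simp [h]
    · rw [Real.sign_of_pos h, Real.sign_of_neg (by linarith)]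
  rw [excess, excess, spread_neg, this]
  ring

/-- If the range is attained as s_j - s_k, the excess is minus the sum of the steps over [j, n)
minus that over [0, k), and a positive drift works against both. Splitting off `γ` leaves five
terms, two controlled by `Q` and three by `R`; the factor 5 for the square of five terms gives 10
and 15. -/
lemma excess_sq_le {a : ℝ} (ha : 0 < a) (x β γ : ℕ → ℝ) (hx : ∀ i, x i = a + β i + γ i) (n : ℕ)
    {Q R : ℝ} (hR : ∀ j ≤ n, (∑ i ∈ Finset.range j, γ i) ^ 2 ≤ R)
    (hQ : ∀ j ≤ n, max (∑ i ∈ Finset.range j, (-a - β i)) 0 ^ 2 ≤ Q)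
    (hQ' : ∀ j ≤ n, max (∑ i ∈ Finset.Ico j n, (-a - β i)) 0 ^ 2 ≤ Q) :
    excess a (fun j => ∑ i ∈ Finset.range j, x i) n ^ 2 ≤ 10 * Q + 15 * R := by
  have hnn := excess_nonneg a (fun j => ∑ i ∈ Finset.range j, x i) (by simp) n
  obtain ⟨j, hj, k, hk, h⟩ := exists_spread_eq Finset.nonempty_range_add_one
    (s := Finset.range (n + 1)) (fun j => ∑ i ∈ Finset.range j, x i)
  have hj : j ≤ n := Nat.lt_succ_iff.1 (Finset.mem_range.1 hj)
  have hk : k ≤ n := Nat.lt_succ_iff.1 (Finset.mem_range.1 hk)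
  have e1 : excess a (fun j => ∑ i ∈ Finset.range j, x i) n
      = ∑ i ∈ Finset.Ico j n, (-a - β i) + ∑ i ∈ Finset.range k, (-a - β i)
        + ∑ i ∈ Finset.range j, γ i - ∑ i ∈ Finset.range n, γ i - ∑ i ∈ Finset.range k, γ i := by
    rw [excess, h, Real.sign_of_pos ha, one_mul]
    have hxs : ∀ m, ∑ i ∈ Finset.range m, x i
        = ∑ i ∈ Finset.range m, γ i - ∑ i ∈ Finset.range m, (-a - β i) := fun m => by
      rw [← Finset.sum_sub_distrib]
      exact Finset.sum_congr rfl fun i _ => by rw [hx]; ring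
    have hIco := Finset.sum_range_add_sum_Ico (fun i => -a - β i) hj
    simp only [hxs]
    linarith
  -- Positive parts are taken because only they are small; the excess being nonnegative, the
  -- inequality can still be squared.
  have e2 : excess a (fun j => ∑ i ∈ Finset.range j, x i) n
      ≤ max (∑ i ∈ Finset.Ico j n, (-a - β i)) 0 + max (∑ i ∈ Finset.range k, (-a - β i)) 0
        + ∑ i ∈ Finset.range j, γ i - ∑ i ∈ Finset.range n, γ i - ∑ i ∈ Finset.range k, γ i := by
    rw [e1]
    gcongr <;> exact le_max_left _ _
  have hsq : ∀ p q r s t : ℝ, (p + q + r - s - t) ^ 2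
      ≤ 5 * (p ^ 2 + q ^ 2 + r ^ 2 + s ^ 2 + t ^ 2) := fun p q r s t => by
    nlinarith [sq_nonneg (p - q), sq_nonneg (p - r), sq_nonneg (p + s), sq_nonneg (p + t),
      sq_nonneg (q - r), sq_nonneg (q + s), sq_nonneg (q + t), sq_nonneg (r + s),
      sq_nonneg (r + t), sq_nonneg (s - t)]
  refine (pow_le_pow_left₀ hnn e2 2).trans ((hsq _ _ _ _ _).trans ?_)
  linarith [hR j hj, hR n le_rfl, hR k hk, hQ k hk, hQ' j hj]

lemma integrable_of_sq_le {Ω : Type*} [MeasurableSpace Ω] {P : Measure Ω} {f g : Ω → ℝ}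
    (hf : Measurable f) (hg : Integrable g P)
    (h : ∀ ω, f ω ^ 2 ≤ g ω) : Integrable (fun ω => f ω ^ 2) P :=
  hg.mono' (hf.pow_const 2).aestronglyMeasurable
    (ae_of_all _ fun ω => by rw [Real.norm_eq_abs, abs_of_nonneg (sq_nonneg _)]; exact h ω)

lemma measurable_excess {α : Type*} [MeasurableSpace α] {a : α → ℝ} (ha : Measurable a)
    {S : ℕ → α → ℝ} (hS : ∀ j, Measurable (S j)) (n : ℕ) :
    Measurable fun ω => excess (a ω) (fun j => S j ω) n :=
  (measurable_spread _ fun i _ => hS i).sub ((Real.measurable_sign.comp ha).mul (hS n))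

lemma max_zero_sq_le_exp {l : ℝ} (hl : 0 < l) (x : ℝ) :
    max x 0 ^ 2 ≤ 2 / l ^ 2 * Real.exp (l * x) := by
  have hpos := Real.exp_pos (l * x)
  rcases le_total x 0 with h | h
  · rw [max_eq_right h]
    simp only [ne_eq, OfNat.ofNat_ne_zero, not_false_eq_true, zero_pow]
    positivity
  · rw [max_eq_left h, div_mul_eq_mul_div, le_div_iff₀ (by positivity)]
    nlinarith [Real.quadratic_le_exp_of_nonneg (mul_nonneg hl.le h), mul_nonneg hl.le h]

section OneDim

variable {Ω : Type*} [mΩ : MeasurableSpace Ω] {P : Measure Ω} [IsProbabilityMeasure P]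
  {ξ : ℕ → Ω → ℝ}

/-- All fluctuation is put into `γ`, with `β = 0` and `Q = 0`; the constant is 15 · 8. This crude
bound is uniform in the direction of projection and later serves as the dominating function. -/
lemma integral_excess_sq_le_of_pos (hm : ∀ i, Measurable (ξ i)) (hind : iIndepFun ξ P)
    (hid : ∀ i, IdentDistrib (ξ i) (ξ 0) P P) (hL2 : MemLp (ξ 0) 2 P)
    (ha : 0 < ∫ ω, ξ 0 ω ∂P) (n : ℕ) :
    Integrable (fun ω => excess (∫ ω, ξ 0 ω ∂P) (fun j => ∑ i ∈ Finset.range j, ξ i ω) n ^ 2) P ∧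
    ∫ ω, excess (∫ ω, ξ 0 ω ∂P) (fun j => ∑ i ∈ Finset.range j, ξ i ω) n ^ 2 ∂P
      ≤ 120 * variance (ξ 0) P * n := by
  set a := ∫ ω, ξ 0 ω ∂P with ha_def
  have hL2' : ∀ i, MemLp (ξ i) 2 P := fun i => (hid i).memLp_iff.2 hL2
  obtain ⟨R, hRi, hR, hRle⟩ := exists_dominating_partialSum_sq (P := P) (ξ := fun i ω => ξ i ω - a)
    (fun i => (hm i).sub_const a) (hind.comp (fun _ x => x - a) fun _ => measurable_id.sub_const a)
    (fun i => (hL2' i).sub (memLp_const a)) (fun i => by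
      rw [integral_sub ((hL2' i).integrable (by norm_num)) (integrable_const a),
        (hid i).integral_eq]
      simp [ha_def]) (v := variance (ξ 0) P) (fun i => by
      rw [← (hid i).variance_eq, variance_eq_integral (hm i).aemeasurable, (hid i).integral_eq]) n
  have hle : ∀ ω, excess a (fun j => ∑ i ∈ Finset.range j, ξ i ω) n ^ 2 ≤ 15 * R ω := fun ω => by
    have := excess_sq_le ha (fun i => ξ i ω) (fun _ => 0) (fun i => ξ i ω - a) (fun i => by ring) n
      (Q := 0) (hRle ω) (fun j _ => ?_) (fun j _ => ?_)
    · linarith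
    · rw [max_eq_right (Finset.sum_nonpos fun i _ => by linarith)]; simp
    · rw [max_eq_right (Finset.sum_nonpos fun i _ => by linarith)]; simp
  have hmeas : Measurable fun ω => excess a (fun j => ∑ i ∈ Finset.range j, ξ i ω) n :=
    measurable_excess measurable_const (fun j => Finset.measurable_sum _ fun i _ => hm i) n
  have hint := integrable_of_sq_le hmeas (hRi.const_mul 15) hle
  refine ⟨hint, (integral_mono hint (hRi.const_mul 15) hle).trans ?_⟩
  rw [integral_const_mul]
  linarith

/-- Here `β` is the centered truncated step and `γ` the centered remainder. The contribution of `β`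
is bounded independently of `n`, that of `γ` is at most `ε * n`. -/
lemma exists_integral_excess_sq_le_of_pos (hm : ∀ i, Measurable (ξ i)) (hind : iIndepFun ξ P)
    (hid : ∀ i, IdentDistrib (ξ i) (ξ 0) P P) (hL2 : MemLp (ξ 0) 2 P)
    (ha : 0 < ∫ ω, ξ 0 ω ∂P) {ε : ℝ} (hε : 0 < ε) :
    ∃ C : ℝ, ∀ n : ℕ,
      ∫ ω, excess (∫ ω, ξ 0 ω ∂P) (fun j => ∑ i ∈ Finset.range j, ξ i ω) n ^ 2 ∂P
        ≤ C + ε * n := by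
  set a := ∫ ω, ξ 0 ω ∂P with ha_def
  have hL2' : ∀ i, MemLp (ξ i) 2 P := fun i => (hid i).memLp_iff.2 hL2
  -- The share 1/120 compensates the factor 15 · 8 of `excess_sq_le` and Doob's inequality.
  obtain ⟨φ, K, hφm, hφK, hφε⟩ := exists_truncation hL2 (show 0 < ε / 120 by positivity)
  have hφL2 : ∀ i, MemLp (fun ω => φ (ξ i ω)) 2 P := fun i =>
    MemLp.of_bound (hφm.comp (hm i)).aestronglyMeasurable K (ae_of_all _ fun ω => hφK _)
  set b := ∫ ω, φ (ξ 0 ω) ∂P with hb_def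
  have hb : ∀ i, ∫ ω, φ (ξ i ω) ∂P = b := fun i => ((hid i).comp hφm).integral_eq
  -- the bounded part
  have hβm : Measurable fun x => φ x - b := hφm.sub_const b
  have hβb : |b| ≤ K := by
    have := norm_integral_le_of_norm_le_const (μ := P) (f := fun ω => φ (ξ 0 ω))
      (ae_of_all _ fun ω => hφK (ξ 0 ω))
    simpa using this
  obtain ⟨l, r, hl, hr0, hr1, hexp⟩ := exists_exp_moment_le (P := P)
    (β := fun i ω => φ (ξ i ω) - b) (fun i => hβm.comp (hm i))
    (hind.comp (fun _ x => φ x - b) fun _ => hβm) (c := 2 * K)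
    (fun i ω => (abs_sub _ _).trans (by linarith [hφK (ξ i ω)])) (fun i => by
      rw [integral_sub ((hφL2 i).integrable (by norm_num)) (integrable_const b), hb]; simp) ha
  -- the remainder, of small variance
  have hγm : Measurable fun x => x - φ x - (a - b) := (measurable_id.sub hφm).sub_const _
  have hγL2 : ∀ i, MemLp (fun ω => ξ i ω - φ (ξ i ω)) 2 P := fun i => (hL2' i).sub (hφL2 i)
  have hγ0 : ∀ i, ∫ ω, (ξ i ω - φ (ξ i ω)) ∂P = a - b := fun i => by
    rw [integral_sub ((hL2' i).integrable (by norm_num)) ((hφL2 i).integrable (by norm_num)), hb,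
      (hid i).integral_eq]
  set v := ∫ ω, (ξ 0 ω - φ (ξ 0 ω) - (a - b)) ^ 2 ∂P with hv_def
  have hv : v ≤ ε / 120 := by
    have h1 := variance_eq_integral (hγL2 0).1.aemeasurable
    rw [hγ0 0] at h1
    have h2 := variance_le_expectation_sq (hγL2 0).1
    rw [h1] at h2
    exact h2.trans hφε.le
  have hvi : ∀ i, ∫ ω, (ξ i ω - φ (ξ i ω) - (a - b)) ^ 2 ∂P = v := fun i =>
    ((hid i).comp (hγm.pow_const 2)).integral_eq
  have hdom := fun n => exists_dominating_partialSum_sq (P := P)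
    (ξ := fun i ω => ξ i ω - φ (ξ i ω) - (a - b)) (fun i => hγm.comp (hm i))
    (hind.comp (fun _ x => x - φ x - (a - b)) fun _ => hγm)
    (fun i => (hγL2 i).sub (memLp_const _)) (fun i => by
      rw [integral_sub ((hγL2 i).integrable (by norm_num)) (integrable_const _), hγ0]; simp) hvi n
  refine ⟨10 * (2 / l ^ 2 * (2 * (1 - r)⁻¹)), fun n => ?_⟩
  obtain ⟨R, hRi, hR, hRle⟩ := hdom n
  set E : Finset ℕ → Ω → ℝ := fun s ω => Real.exp (l * ∑ i ∈ s, (-a - (φ (ξ i ω) - b))) with hE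
  -- The maximum over `j` is replaced by a sum of exponentials. Initial and final stretches each
  -- contribute at most a geometric series, so the mean of `T` is bounded in `n`.
  set T : Ω → ℝ := fun ω => ∑ j ∈ Finset.range (n + 1),
    (E (Finset.range j) ω + E (Finset.Ico j n) ω) with hT
  have hEpos : ∀ s ω, 0 ≤ E s ω := fun s ω => (Real.exp_pos _).le
  have hEi : ∀ j, Integrable (fun ω => E (Finset.range j) ω + E (Finset.Ico j n) ω) P :=
    fun j => (hexp _).1.add (hexp _).1
  have hTi : Integrable T P := integrable_finsetSum _ fun j _ => hEi j
  have hgeom : ∑ j ∈ Finset.range (n + 1), r ^ j ≤ (1 - r)⁻¹ := by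
    rw [← tsum_geometric_of_lt_one hr0 hr1]
    exact (summable_geometric_of_lt_one hr0 hr1).sum_le_tsum _ fun i _ => pow_nonneg hr0 i
  have hTle : ∫ ω, T ω ∂P ≤ 2 * (1 - r)⁻¹ := by
    rw [hT, integral_finsetSum _ fun j _ => hEi j]
    have h1 : ∀ j ∈ Finset.range (n + 1), ∫ ω, (E (Finset.range j) ω + E (Finset.Ico j n) ω) ∂P
        ≤ r ^ j + r ^ (n - j) := fun j _ => by
      rw [integral_add (hexp _).1 (hexp _).1]
      have h1 := (hexp (Finset.range j)).2
      have h2 := (hexp (Finset.Ico j n)).2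
      rw [Finset.card_range] at h1
      rw [Nat.card_Ico] at h2
      exact add_le_add h1 h2
    refine (Finset.sum_le_sum h1).trans ?_
    have h2 := Finset.sum_range_reflect (fun j => r ^ j) (n + 1)
    simp only [Nat.add_sub_cancel] at h2
    rw [Finset.sum_add_distrib, show ∑ j ∈ Finset.range (n + 1), r ^ (n - j)
      = ∑ j ∈ Finset.range (n + 1), r ^ j from h2 ▸ rfl]
    linarith
  have hle : ∀ ω, excess a (fun j => ∑ i ∈ Finset.range j, ξ i ω) n ^ 2
      ≤ 10 * (2 / l ^ 2 * T ω) + 15 * R ω := fun ω => by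
    refine excess_sq_le ha (fun i => ξ i ω) (fun i => φ (ξ i ω) - b)
      (fun i => ξ i ω - φ (ξ i ω) - (a - b)) (fun i => by ring) n (hRle ω)
      (fun j hj => (max_zero_sq_le_exp hl _).trans ?_)
      (fun j hj => (max_zero_sq_le_exp hl _).trans ?_)
    · refine mul_le_mul_of_nonneg_left ?_ (by positivity)
      refine le_trans (le_add_of_nonneg_right (hEpos (Finset.Ico j n) ω)) ?_
      exact Finset.single_le_sum (f := fun j => E (Finset.range j) ω + E (Finset.Ico j n) ω)
        (fun i _ => add_nonneg (hEpos _ _) (hEpos _ _)) (Finset.mem_range.2 (by omega))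
    · refine mul_le_mul_of_nonneg_left ?_ (by positivity)
      refine le_trans (le_add_of_nonneg_left (hEpos (Finset.range j) ω)) ?_
      exact Finset.single_le_sum (f := fun j => E (Finset.range j) ω + E (Finset.Ico j n) ω)
        (fun i _ => add_nonneg (hEpos _ _) (hEpos _ _)) (Finset.mem_range.2 (by omega))
  have hI : Integrable (fun ω => 10 * (2 / l ^ 2 * T ω) + 15 * R ω) P :=
    ((hTi.const_mul _).const_mul _).add (hRi.const_mul _)
  refine (integral_mono (integral_excess_sq_le_of_pos hm hind hid hL2 ha n).1 hI hle).trans ?_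
  rw [integral_add ((hTi.const_mul _).const_mul _) (hRi.const_mul _), integral_const_mul,
    integral_const_mul, integral_const_mul]
  have h1 : 2 / l ^ 2 * ∫ ω, T ω ∂P ≤ 2 / l ^ 2 * (2 * (1 - r)⁻¹) := by gcongr
  have h2 : (n : ℝ) * v ≤ n * (ε / 120) := by gcongr
  linarith

/-- For a random walk on the line with nonzero drift the excess is bounded in `L²` by a multiple
of `√n`, and is of smaller order than `√n`. -/
theorem excess_moments (hm : ∀ i, Measurable (ξ i)) (hind : iIndepFun ξ P)
    (hid : ∀ i, IdentDistrib (ξ i) (ξ 0) P P) (hL2 : MemLp (ξ 0) 2 P)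
    (ha : ∫ ω, ξ 0 ω ∂P ≠ 0) :
    (∀ n, Integrable
      (fun ω => excess (∫ ω, ξ 0 ω ∂P) (fun j => ∑ i ∈ Finset.range j, ξ i ω) n ^ 2) P) ∧
    (∀ n : ℕ, ∫ ω, excess (∫ ω, ξ 0 ω ∂P) (fun j => ∑ i ∈ Finset.range j, ξ i ω) n ^ 2 ∂P
      ≤ 120 * variance (ξ 0) P * n) ∧
    Tendsto (fun n : ℕ =>
      (∫ ω, excess (∫ ω, ξ 0 ω ∂P) (fun j => ∑ i ∈ Finset.range j, ξ i ω) n ^ 2 ∂P) / n)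
      atTop (𝓝 0) := by
  have hlim : ∀ f : ℕ → ℝ, (∀ n, 0 ≤ f n) → (∀ ε > 0, ∃ C, ∀ n : ℕ, f n ≤ C + ε * n) →
      Tendsto (fun n : ℕ => f n / n) atTop (𝓝 0) := by
    intro f hf h
    rw [tendsto_order]
    refine ⟨fun x hx => Eventually.of_forall fun n =>
      hx.trans_le (div_nonneg (hf n) (Nat.cast_nonneg n)), fun x hx => ?_⟩
    obtain ⟨C, hC⟩ := h (x / 2) (by linarith)
    have h0 := tendsto_const_div_atTop_nhds_zero_nat C
    filter_upwards [(tendsto_order.1 h0).2 (x / 2) (by linarith), eventually_gt_atTop 0]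
      with n hn hn0
    have hn0' : (0 : ℝ) < n := by exact_mod_cast hn0
    rw [div_lt_iff₀ hn0'] at hn ⊢
    linarith [hC n]
  rcases lt_or_gt_of_ne ha with ha | ha
  · have hm' : ∀ i, Measurable (fun ω => -ξ i ω) := fun i => (hm i).neg
    have hind' : iIndepFun (fun i ω => -ξ i ω) P :=
      hind.comp (fun _ x => -x) fun _ => measurable_neg
    have hid' : ∀ i, IdentDistrib (fun ω => -ξ i ω) (fun ω => -ξ 0 ω) P P := fun i =>
      (hid i).comp measurable_neg
    have ha' : 0 < ∫ ω, -ξ 0 ω ∂P := by rw [integral_neg]; linarith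
    have e : ∀ n ω, excess (∫ ω, -ξ 0 ω ∂P) (fun j => ∑ i ∈ Finset.range j, -ξ i ω) n
        = excess (∫ ω, ξ 0 ω ∂P) (fun j => ∑ i ∈ Finset.range j, ξ i ω) n := fun n ω => by
      rw [← excess_neg (∫ ω, ξ 0 ω ∂P), integral_neg]
      simp only [Finset.sum_neg_distrib]
    have hv : variance (fun ω => -ξ 0 ω) P = variance (ξ 0) P := variance_fun_neg
    have h1 := integral_excess_sq_le_of_pos hm' hind' hid' hL2.neg ha'
    have h2 := @exists_integral_excess_sq_le_of_pos _ _ _ _ _ hm' hind' hid' hL2.neg ha'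
    simp only [e, hv] at h1 h2
    exact ⟨fun n => (h1 n).1, fun n => (h1 n).2,
      hlim _ (fun n => integral_nonneg fun ω => sq_nonneg _) fun ε hε => h2 hε⟩
  · have h1 := integral_excess_sq_le_of_pos hm hind hid hL2 ha
    exact ⟨fun n => (h1 n).1, fun n => (h1 n).2,
      hlim _ (fun n => integral_nonneg fun ω => sq_nonneg _)
        fun ε hε => exists_integral_excess_sq_le_of_pos hm hind hid hL2 ha hε⟩

end OneDim

/-! ### Averaging the excess over directions. -/

lemma sq_integral_le_measure_mul_integral_sq {α : Type*} [MeasurableSpace α] {ν : Measure α}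
    [IsFiniteMeasure ν] {f : α → ℝ} (hf : MemLp f 2 ν) :
    (∫ x, f x ∂ν) ^ 2 ≤ ν.real Set.univ * ∫ x, f x ^ 2 ∂ν := by
  set m := ν.real Set.univ with hm
  set I := ∫ x, f x ∂ν with hI
  have hfi : Integrable f ν := hf.integrable (by norm_num)
  have hf2 := hf.integrable_sq
  have h0 : 0 ≤ ∫ x, (m ^ 2 * f x ^ 2 - 2 * m * I * f x + I ^ 2) ∂ν :=
    integral_nonneg fun x => by
      change 0 ≤ m ^ 2 * f x ^ 2 - 2 * m * I * f x + I ^ 2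
      nlinarith [sq_nonneg (m * f x - I)]
  rw [integral_add (f := fun x => m ^ 2 * f x ^ 2 - 2 * m * I * f x)
      ((hf2.const_mul _).sub (hfi.const_mul _)) (integrable_const _),
    integral_sub (hf2.const_mul _) (hfi.const_mul _), integral_const_mul, integral_const_mul,
    integral_const, smul_eq_mul, ← hm, ← hI] at h0
  rcases (measureReal_nonneg : 0 ≤ ν.real Set.univ).eq_or_lt with h | h
  · have hν : ν = 0 := by
      rw [← Measure.measure_univ_eq_zero]
      exact (measureReal_eq_zero_iff).1 h.symm
    rw [hI, hν]
    simp
  · have h1 : 0 ≤ m * (m * ∫ x, f x ^ 2 ∂ν - I ^ 2) := by linarith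
    have h2 := nonneg_of_mul_nonneg_right h1 h
    linarith

/-- The exceptional directions are zeros of a shifted cosine, hence countably many. -/
lemma ae_inner_unitVec_ne_zero {ν : Plane} (hν : ν ≠ 0) :
    ∀ᵐ θ ∂angleMeasure, inner ℝ ν (unitVec θ) ≠ 0 := by
  obtain ⟨α, hα⟩ := ν.exists_polar
  have hr : ‖ν‖ ≠ 0 := norm_ne_zero_iff.2 hν
  refine ae_restrict_of_ae ?_
  have hc : (Set.range fun k : ℤ => (2 * k + 1) * Real.pi / 2 + α).Countable :=
    Set.countable_range _
  filter_upwards [hc.ae_notMem volume] with θ hθ h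
  rw [hα, inner_smul_unitVec, mul_eq_zero, or_iff_right hr, Real.cos_eq_zero_iff] at h
  obtain ⟨k, hk⟩ := h
  exact hθ ⟨k, by simp only; linarith⟩

lemma measurable_spread_inner {ι : Type*} {s : Finset ι} (hs : s.Nonempty) {α : Type*}
    [MeasurableSpace α] {f : ι → α → Plane} (hf : ∀ i, Measurable (f i)) :
    Measurable fun x : α × ℝ => spread s hs fun i => inner ℝ (f i x.1) (unitVec x.2) :=
  measurable_spread hs fun i _ =>
    ((hf i).comp measurable_fst).inner (continuous_unitVec.measurable.comp measurable_snd)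

lemma spread_inner_unitVec_le {ι : Type*} {s : Finset ι} (hs : s.Nonempty) (f : ι → Plane) (θ : ℝ) :
    spread s hs (fun i => inner ℝ (f i) (unitVec θ)) ≤ 2 * ∑ i ∈ s, ‖f i‖ := by
  obtain ⟨i, hi, j, hj, h⟩ := exists_spread_eq hs fun i => inner ℝ (f i) (unitVec θ)
  have hn : ∀ v : Plane, |inner ℝ v (unitVec θ)| ≤ ‖v‖ := fun v => by
    simpa [norm_unitVec] using abs_real_inner_le_norm v (unitVec θ)
  have hle : ∀ i ∈ s, ‖f i‖ ≤ ∑ i ∈ s, ‖f i‖ := fun i hi =>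
    Finset.single_le_sum (f := fun i => ‖f i‖) (fun _ _ => norm_nonneg _) hi
  have h1 := (abs_le.1 (hn (f i))).2
  have h2 := (abs_le.1 (hn (f j))).1
  linarith [hle i hi, hle j hj]

lemma integrable_spread_inner {ι : Type*} {s : Finset ι} (hs : s.Nonempty) (f : ι → Plane) :
    Integrable (fun θ => spread s hs fun i => inner ℝ (f i) (unitVec θ)) angleMeasure := by
  refine Integrable.of_bound (C := 2 * ∑ i ∈ s, ‖f i‖) ?_ (ae_of_all _ fun θ => ?_)
  · exact (measurable_spread hs fun i _ =>
      measurable_const.inner continuous_unitVec.measurable).aestronglyMeasurable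
  · rw [Real.norm_eq_abs, abs_of_nonneg (spread_nonneg hs _)]
    exact spread_inner_unitVec_le hs f θ

/-- The excess of the projection of a planar path, in terms of the angle of projection. -/
noncomputable def angleExcess (ν : Plane) (s : ℕ → Plane) (n : ℕ) (θ : ℝ) : ℝ :=
  excess (inner ℝ ν (unitVec θ)) (fun j => inner ℝ (s j) (unitVec θ)) n

lemma integrable_angleExcess (ν : Plane) (s : ℕ → Plane) (n : ℕ) :
    Integrable (angleExcess ν s n) angleMeasure :=
  (integrable_spread_inner _ s).sub (integrable_sign_inner_mul_inner ν (s n))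

lemma inner_walk {Ω : Type*} {Z : ℕ → Ω → Plane} (n : ℕ) (ω : Ω) (u : Plane) :
    inner ℝ (walk Z n ω) u = ∑ i ∈ Finset.range n, inner ℝ (Z i ω) u := by
  rw [walk, sum_inner]

section Walk

variable {Ω : Type*} [MeasurableSpace Ω] {P : Measure Ω} {Z : ℕ → Ω → Plane}

lemma measurable_walk (hm : ∀ i, Measurable (Z i)) (n : ℕ) : Measurable (walk Z n) :=
  Finset.measurable_sum _ fun i _ => hm i

lemma measurable_angleExcess_walk (hm : ∀ i, Measurable (Z i)) (ν : Plane) (n : ℕ) :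
    Measurable fun x : ℝ × Ω => angleExcess ν (fun j => walk Z j x.2) n x.1 := by
  have hu : Measurable fun x : ℝ × Ω => unitVec x.1 :=
    continuous_unitVec.measurable.comp measurable_fst
  exact measurable_excess (measurable_const.inner hu)
    (fun j => ((measurable_walk hm j).comp measurable_snd).inner hu) n

variable [IsProbabilityMeasure P]

/-- The mean excess over all directions, for a planar random walk with nonzero drift, is of smaller
order than `√n` in `L²`. -/
theorem integral_angleExcess_moments (hm : ∀ i, Measurable (Z i)) (hind : iIndepFun Z P)
    (hid : ∀ i, IdentDistrib (Z i) (Z 0) P P) (hL2 : MemLp (Z 0) 2 P)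
    (hμ : meanVec P (Z 0) ≠ 0) :
    (∀ n, MemLp
      (fun ω => ∫ θ, angleExcess (meanVec P (Z 0)) (fun j => walk Z j ω) n θ ∂angleMeasure) 2 P) ∧
    Tendsto (fun n : ℕ => (∫ ω, (∫ θ, angleExcess (meanVec P (Z 0)) (fun j => walk Z j ω) n θ
      ∂angleMeasure) ^ 2 ∂P) / n) atTop (𝓝 0) := by
  set μ := meanVec P (Z 0) with hμ_def
  set X : ℕ → ℝ → Ω → ℝ := fun n θ ω => angleExcess μ (fun j => walk Z j ω) n θ with hX
  have hXm : ∀ n, Measurable (Function.uncurry (X n)) := fun n =>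
    measurable_angleExcess_walk hm μ n
  set V := ∫ ω, ‖Z 0 ω‖ ^ 2 ∂P with hV
  have hVi : Integrable (fun ω => ‖Z 0 ω‖ ^ 2) P := hL2.norm.integrable_sq
  have hu : ∀ θ, Measurable fun v : Plane => inner ℝ v (unitVec θ) := fun θ =>
    measurable_id.inner measurable_const
  have hmean : ∀ θ, ∫ ω, inner ℝ (Z 0 ω) (unitVec θ) ∂P = inner ℝ μ (unitVec θ) := fun θ => by
    simp only [real_inner_comm (unitVec θ), hμ_def, meanVec]
    exact integral_inner (hL2.integrable (by norm_num)) _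
  have hproj : ∀ θ, MemLp (fun ω => inner ℝ (Z 0 ω) (unitVec θ)) 2 P := fun θ =>
    hL2.norm.mono ((hu θ).comp (hm 0)).aestronglyMeasurable (ae_of_all _ fun ω => by
      simpa [norm_unitVec] using abs_real_inner_le_norm (Z 0 ω) (unitVec θ))
  have hvar : ∀ θ, variance (fun ω => inner ℝ (Z 0 ω) (unitVec θ)) P ≤ V := fun θ => by
    refine (variance_le_expectation_sq (hproj θ).1).trans
      (integral_mono (hproj θ).integrable_sq hVi fun ω => ?_)
    have := abs_real_inner_le_norm (Z 0 ω) (unitVec θ)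
    rw [norm_unitVec, mul_one] at this
    simpa using sq_le_sq' (abs_le.1 this).1 (abs_le.1 this).2
  have hmom : ∀ θ, inner ℝ μ (unitVec θ) ≠ 0 →
      (∀ n, Integrable (fun ω => X n θ ω ^ 2) P) ∧
      (∀ n : ℕ, ∫ ω, X n θ ω ^ 2 ∂P ≤ 120 * V * n) ∧
      Tendsto (fun n : ℕ => (∫ ω, X n θ ω ^ 2 ∂P) / n) atTop (𝓝 0) := by
    intro θ hθ
    have := excess_moments (P := P) (ξ := fun i ω => inner ℝ (Z i ω) (unitVec θ))
      (fun i => (hu θ).comp (hm i)) (hind.comp (fun _ v => inner ℝ v (unitVec θ)) fun _ => hu θ)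
      (fun i => (hid i).comp (hu θ)) (hproj θ) (by rwa [hmean])
    rw [hmean] at this
    simp only [← inner_walk] at this
    refine ⟨this.1, fun n => (this.2.1 n).trans ?_, this.2.2⟩
    have := hvar θ
    gcongr
  have hae : ∀ᵐ θ ∂angleMeasure, inner ℝ μ (unitVec θ) ≠ 0 := ae_inner_unitVec_ne_zero hμ
  have hX2m : ∀ n, Measurable (fun x : ℝ × Ω => X n x.1 x.2 ^ 2) := fun n => (hXm n).pow_const 2
  have hEm : ∀ n, AEStronglyMeasurable (fun θ => ∫ ω, X n θ ω ^ 2 ∂P) angleMeasure := fun n =>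
    (hX2m n).stronglyMeasurable.integral_prod_right.aestronglyMeasurable
  have hEn : ∀ n θ, ‖∫ ω, X n θ ω ^ 2 ∂P‖ = ∫ ω, X n θ ω ^ 2 ∂P := fun n θ => by
    rw [Real.norm_eq_abs, abs_of_nonneg (integral_nonneg fun ω => sq_nonneg _)]
  have hprod : ∀ n, Integrable (fun x : ℝ × Ω => X n x.1 x.2 ^ 2) (angleMeasure.prod P) := by
    intro n
    rw [integrable_prod_iff (hX2m n).aestronglyMeasurable]
    refine ⟨hae.mono fun θ hθ => (hmom θ hθ).1 n, ?_⟩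
    simp only [norm_pow, Real.norm_eq_abs, sq_abs]
    exact Integrable.of_bound (hEm n) (120 * V * n) (hae.mono fun θ hθ => by
      rw [hEn]; exact (hmom θ hθ).2.1 n)
  have hGm : ∀ n, AEStronglyMeasurable (fun ω => ∫ θ, X n θ ω ∂angleMeasure) P := fun n =>
    (hXm n).stronglyMeasurable.integral_prod_left.aestronglyMeasurable
  have hJensen : ∀ n, ∀ᵐ ω ∂P, (∫ θ, X n θ ω ∂angleMeasure) ^ 2
      ≤ angleMeasure.real Set.univ * ∫ θ, X n θ ω ^ 2 ∂angleMeasure := fun n => by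
    filter_upwards [(hprod n).prod_left_ae] with ω hω
    refine sq_integral_le_measure_mul_integral_sq ?_
    exact (memLp_two_iff_integrable_sq
      (integrable_angleExcess μ (fun j => walk Z j ω) n).1).2 hω
  have hRHS : ∀ n, Integrable
      (fun ω => angleMeasure.real Set.univ * ∫ θ, X n θ ω ^ 2 ∂angleMeasure) P := fun n =>
    (hprod n).integral_prod_right.const_mul _
  have hGi : ∀ n, Integrable (fun ω => (∫ θ, X n θ ω ∂angleMeasure) ^ 2) P := fun n =>
    (hRHS n).mono' ((hGm n).pow 2) ((hJensen n).mono fun ω hω => by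
      rwa [Real.norm_eq_abs, abs_of_nonneg (sq_nonneg _)])
  refine ⟨fun n => (memLp_two_iff_integrable_sq (hGm n)).2 (hGi n), ?_⟩
  have hbound : ∀ n : ℕ, (∫ ω, (∫ θ, X n θ ω ∂angleMeasure) ^ 2 ∂P) / n
      ≤ angleMeasure.real Set.univ * ∫ θ, (∫ ω, X n θ ω ^ 2 ∂P) / n ∂angleMeasure := fun n => by
    rw [integral_div, ← mul_div_assoc]
    refine div_le_div_of_nonneg_right ?_ (Nat.cast_nonneg n)
    refine (integral_mono_ae (hGi n) (hRHS n) (hJensen n)).trans (le_of_eq ?_)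
    rw [integral_const_mul, integral_integral_swap (f := fun θ ω => X n θ ω ^ 2) (hprod n)]
  -- The one-dimensional limit comes without a rate uniform in `θ`, and fails to be available where
  -- the projected drift vanishes; the uniform bound `120 * V` is what permits dominated
  -- convergence.
  have hdct : Tendsto (fun n : ℕ => ∫ θ, (∫ ω, X n θ ω ^ 2 ∂P) / n ∂angleMeasure) atTop
      (𝓝 (∫ _, (0 : ℝ) ∂angleMeasure)) := by
    refine tendsto_integral_of_dominated_convergence (fun _ => 120 * V)
      (fun n => (hEm n).mul_const _) (integrable_const _) (fun n => hae.mono fun θ hθ => ?_)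
      (hae.mono fun θ hθ => (hmom θ hθ).2.2)
    have hV0 : 0 ≤ V := integral_nonneg fun ω => sq_nonneg _
    rw [norm_div, hEn, Real.norm_natCast]
    exact div_le_of_le_mul₀ (Nat.cast_nonneg n) (by positivity) ((hmom θ hθ).2.1 n)
  rw [integral_zero] at hdct
  have hdct' := hdct.const_mul (angleMeasure.real Set.univ)
  rw [mul_zero] at hdct'
  exact squeeze_zero (fun n => div_nonneg (integral_nonneg fun ω => sq_nonneg _)
    (Nat.cast_nonneg n)) hbound hdct'

end Walk

/-! ### The hull of two paths compared with the triangle of their endpoints. -/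

lemma spread_image {ι κ : Type*} [DecidableEq κ] {s : Finset ι} (hs : s.Nonempty) (g : ι → κ)
    (f : κ → ℝ) : spread (s.image g) (hs.image g) f = spread s hs (fun i => f (g i)) := by
  rw [spread, spread, Finset.sup'_image, Finset.inf'_image]
  rfl

/-- The range of the union of two paths which start at the origin is, up to the excesses, the range
of their endpoints and the origin. -/
lemma spread_disjSum_bounds (a b c : ℝ) (x y : ℕ → ℝ) (hx : x 0 = 0) (hy : y 0 = 0) (n : ℕ)
    (hs : ((Finset.range (n + 1)).disjSum (Finset.range (n + 1))).Nonempty) :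
    (Real.sign a * x n + Real.sign b * y n + Real.sign c * (x n - y n)) / 2
        ≤ spread _ hs (Sum.elim x y) ∧
    spread _ hs (Sum.elim x y)
      ≤ (Real.sign a * x n + Real.sign b * y n + Real.sign c * (x n - y n)) / 2
        + 2 * (excess a x n + excess b y n + excess c (fun j => x j - y j) n) := by
  have hr : (Finset.range (n + 1)).Nonempty := Finset.nonempty_range_add_one
  set s := (Finset.range (n + 1)).disjSum (Finset.range (n + 1)) with hs_def
  have ml : ∀ j ≤ n, Sum.inl j ∈ s := fun j hj =>
    Finset.inl_mem_disjSum.2 (Finset.mem_range.2 (by omega))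
  have mr : ∀ j ≤ n, Sum.inr j ∈ s := fun j hj =>
    Finset.inr_mem_disjSum.2 (Finset.mem_range.2 (by omega))
  have sx := Real.sign_mul_le_abs a (x n)
  have sy := Real.sign_mul_le_abs b (y n)
  have sz := Real.sign_mul_le_abs c (x n - y n)
  have ax := abs_le_spread_range x hx n
  have ay := abs_le_spread_range y hy n
  have az := abs_le_spread_range (fun j => x j - y j) (by simp [hx, hy]) n
  constructor
  -- The range of the three points 0, `x n`, `y n` is half the sum of their mutual distances, and a
  -- frozen sign can only decrease each distance.
  · have h1 := sub_le_spread hs (Sum.elim x y) (ml n le_rfl) (ml 0 (Nat.zero_le n))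
    have h2 := sub_le_spread hs (Sum.elim x y) (ml 0 (Nat.zero_le n)) (ml n le_rfl)
    have h3 := sub_le_spread hs (Sum.elim x y) (mr n le_rfl) (mr 0 (Nat.zero_le n))
    have h4 := sub_le_spread hs (Sum.elim x y) (mr 0 (Nat.zero_le n)) (mr n le_rfl)
    have h5 := sub_le_spread hs (Sum.elim x y) (ml n le_rfl) (mr n le_rfl)
    have h6 := sub_le_spread hs (Sum.elim x y) (mr n le_rfl) (ml n le_rfl)
    simp only [Sum.elim_inl, Sum.elim_inr, hx, hy] at h1 h2 h3 h4 h5 h6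
    rcases abs_cases (x n) with ⟨e1, _⟩ | ⟨e1, _⟩ <;>
    rcases abs_cases (y n) with ⟨e2, _⟩ | ⟨e2, _⟩ <;>
    rcases abs_cases (x n - y n) with ⟨e3, _⟩ | ⟨e3, _⟩ <;>
    rw [e1] at sx <;> rw [e2] at sy <;> rw [e3] at sz <;> linarith
  -- A path leaves the interval between 0 and its endpoint by at most its range minus the length of
  -- that interval.
  · have upper : ∀ f : ℕ → ℝ, f 0 = 0 → ∀ j ≤ n,
        f j ≤ max (f n) 0 + (spread _ hr f - |f n|) ∧
        min (f n) 0 - (spread _ hr f - |f n|) ≤ f j := by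
      intro f hf j hj
      have m1 : j ∈ Finset.range (n + 1) := Finset.mem_range.2 (by omega)
      have m2 : n ∈ Finset.range (n + 1) := by simp
      have m3 : 0 ∈ Finset.range (n + 1) := by simp
      have h1 := sub_le_spread hr f m1 m2
      have h2 := sub_le_spread hr f m1 m3
      have h3 := sub_le_spread hr f m2 m1
      have h4 := sub_le_spread hr f m3 m1
      rw [hf] at h2 h4
      rcases le_total (f n) 0 with h | h
      · rw [max_eq_right h, min_eq_left h, abs_of_nonpos h]
        constructor <;> linarith
      · rw [max_eq_left h, min_eq_right h, abs_of_nonneg h]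
        constructor <;> linarith
    have hmax : max (max (x n) 0) (max (y n) 0) - min (min (x n) 0) (min (y n) 0)
        = (|x n| + |y n| + |x n - y n|) / 2 := by
      rcases le_total (x n) 0 with h1 | h1 <;> rcases le_total (y n) 0 with h2 | h2 <;>
      rcases le_total (x n) (y n) with h3 | h3 <;>
      simp only [h1, h2, h3, max_eq_left, max_eq_right, min_eq_left, min_eq_right, max_self,
        min_self, abs_of_nonneg,
        abs_of_nonpos, sub_nonneg, sub_nonpos] <;> linarith
    have hval : ∀ k ∈ s, Sum.elim x y k ≤ max (max (x n) 0) (max (y n) 0)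
          + ((spread _ hr x - |x n|) + (spread _ hr y - |y n|)) ∧
        min (min (x n) 0) (min (y n) 0) - ((spread _ hr x - |x n|) + (spread _ hr y - |y n|))
          ≤ Sum.elim x y k := by
      intro k hk
      have l1 := le_max_left (max (x n) 0) (max (y n) 0)
      have l2 := le_max_right (max (x n) 0) (max (y n) 0)
      have l3 := min_le_left (min (x n) 0) (min (y n) 0)
      have l4 := min_le_right (min (x n) 0) (min (y n) 0)
      rcases k with j | j
      · have hj : j ≤ n := Nat.lt_succ_iff.1 (Finset.mem_range.1 (Finset.inl_mem_disjSum.1 hk))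
        obtain ⟨u1, u2⟩ := upper x hx j hj
        simp only [Sum.elim_inl]
        constructor <;> linarith
      · have hj : j ≤ n := Nat.lt_succ_iff.1 (Finset.mem_range.1 (Finset.inr_mem_disjSum.1 hk))
        obtain ⟨u1, u2⟩ := upper y hy j hj
        simp only [Sum.elim_inr]
        constructor <;> linarith
    -- An excess is the sum of range minus |endpoint| and |endpoint| minus its signed value, both
    -- nonnegative. The first part pays for overshoots, the second for freezing the signs; from the
    -- difference path only the second is needed.
    obtain ⟨i, hi, j, hj, h⟩ := exists_spread_eq hs (Sum.elim x y)
    rw [h, excess, excess, excess]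
    linarith [(hval i hi).1, (hval j hj).2]

/-- Indexing by times instead of points allows repeated positions and makes the index set
independent of the path. -/
lemma perimeter_pair_eq (x y : ℕ → Plane) (n : ℕ)
    (hs : ((Finset.range (n + 1)).disjSum (Finset.range (n + 1))).Nonempty) :
    polygonPerimeter (convexHull ℝ ({v | ∃ j ≤ n, v = x j} ∪ {v | ∃ j ≤ n, v = y j}))
      = 2⁻¹ * ∫ θ, spread _ hs
          (fun k => inner ℝ (Sum.elim x y k) (unitVec θ)) ∂angleMeasure := by
  classical
  have hF : ({v | ∃ j ≤ n, v = x j} ∪ {v | ∃ j ≤ n, v = y j} : Set Plane)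
      = (((Finset.range (n + 1)).disjSum (Finset.range (n + 1))).image (Sum.elim x y) :
        Finset Plane) := by
    ext v
    simp [eq_comm]
  rw [hF, polygonPerimeter_convexHull _ (hs.image _)]
  exact congrArg _ (integral_congr_ae (ae_of_all _ fun θ => spread_image hs _ _))

/-- The perimeter of the hull of two paths which start at the origin is, up to the excesses, a
linear function of their endpoints. -/
lemma perimeter_pair_bounds {a b : Plane} (ha : a ≠ 0) (hb : b ≠ 0) (hab : a - b ≠ 0)
    (x y : ℕ → Plane) (hx : x 0 = 0) (hy : y 0 = 0) (n : ℕ) :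
    inner ℝ (x n) (‖a‖⁻¹ • a) + inner ℝ (y n) (‖b‖⁻¹ • b)
        + inner ℝ (x n - y n) (‖a - b‖⁻¹ • (a - b))
      ≤ polygonPerimeter (convexHull ℝ ({v | ∃ j ≤ n, v = x j} ∪ {v | ∃ j ≤ n, v = y j})) ∧
    polygonPerimeter (convexHull ℝ ({v | ∃ j ≤ n, v = x j} ∪ {v | ∃ j ≤ n, v = y j}))
      ≤ inner ℝ (x n) (‖a‖⁻¹ • a) + inner ℝ (y n) (‖b‖⁻¹ • b)
        + inner ℝ (x n - y n) (‖a - b‖⁻¹ • (a - b))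
        + (∫ θ, angleExcess a x n θ ∂angleMeasure + ∫ θ, angleExcess b y n θ ∂angleMeasure
          + ∫ θ, angleExcess (a - b) (fun j => x j - y j) n θ ∂angleMeasure) := by
  have hs : ((Finset.range (n + 1)).disjSum (Finset.range (n + 1))).Nonempty :=
    ⟨Sum.inl 0, by simp⟩
  rw [perimeter_pair_eq x y n hs]
  set lin : ℝ → ℝ := fun θ =>
    (Real.sign (inner ℝ a (unitVec θ)) * inner ℝ (x n) (unitVec θ)
      + Real.sign (inner ℝ b (unitVec θ)) * inner ℝ (y n) (unitVec θ)
      + Real.sign (inner ℝ (a - b) (unitVec θ)) * inner ℝ (x n - y n) (unitVec θ)) / 2 with hlin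
  have i1 := integrable_sign_inner_mul_inner a (x n)
  have i2 := integrable_sign_inner_mul_inner b (y n)
  have i3 := integrable_sign_inner_mul_inner (a - b) (x n - y n)
  have ilin : Integrable lin angleMeasure := ((i1.add i2).add i3).div_const 2
  -- The factor 4 of the sign integral is halved in `lin` and halved again by Cauchy's formula, so
  -- the unit vectors end up with coefficient 1.
  have hI : ∫ θ, lin θ ∂angleMeasure = 2 * (inner ℝ (x n) (‖a‖⁻¹ • a)
      + inner ℝ (y n) (‖b‖⁻¹ • b) + inner ℝ (x n - y n) (‖a - b‖⁻¹ • (a - b))) := by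
    have e1 := integral_sign_inner_mul_inner ha (x n)
    have e2 := integral_sign_inner_mul_inner hb (y n)
    have e3 := integral_sign_inner_mul_inner hab (x n - y n)
    simp only [hlin]
    rw [integral_div, integral_add (f := fun θ =>
      Real.sign (inner ℝ a (unitVec θ)) * inner ℝ (x n) (unitVec θ)
      + Real.sign (inner ℝ b (unitVec θ)) * inner ℝ (y n) (unitVec θ)) (i1.add i2) i3,
      integral_add i1 i2, e1, e2, e3]
    ring
  have isp := integrable_spread_inner hs (Sum.elim x y)
  have j1 := integrable_angleExcess a x n
  have j2 := integrable_angleExcess b y n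
  have j3 := integrable_angleExcess (a - b) (fun j => x j - y j) n
  have key : ∀ θ, lin θ ≤ spread _ hs (fun k => inner ℝ (Sum.elim x y k) (unitVec θ)) ∧
      spread _ hs (fun k => inner ℝ (Sum.elim x y k) (unitVec θ))
        ≤ lin θ + 2 * (angleExcess a x n θ + angleExcess b y n θ
          + angleExcess (a - b) (fun j => x j - y j) n θ) := by
    intro θ
    have h := spread_disjSum_bounds (inner ℝ a (unitVec θ)) (inner ℝ b (unitVec θ))
      (inner ℝ (a - b) (unitVec θ)) (fun j => inner ℝ (x j) (unitVec θ))
      (fun j => inner ℝ (y j) (unitVec θ)) (by simp [hx]) (by simp [hy]) n hs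
    have e : (Sum.elim (fun j => inner ℝ (x j) (unitVec θ)) fun j => inner ℝ (y j) (unitVec θ))
        = fun k => inner ℝ (Sum.elim x y k) (unitVec θ) := by
      ext k; cases k <;> rfl
    rw [e] at h
    simpa only [hlin, angleExcess, inner_sub_left] using h
  constructor
  · have := integral_mono ilin isp fun θ => (key θ).1
    rw [hI] at this
    linarith
  · have := integral_mono isp (ilin.add (((j1.add j2).add j3).const_mul 2)) fun θ => (key θ).2
    simp only [Pi.add_apply] at this
    rw [integral_add ilin (g := fun θ => 2 * (angleExcess a x n θ + angleExcess b y n θ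
          + angleExcess (a - b) (fun j => x j - y j) n θ)) (((j1.add j2).add j3).const_mul 2),
      integral_const_mul,
      integral_add (f := fun θ => angleExcess a x n θ + angleExcess b y n θ) (j1.add j2) j3,
      integral_add j1 j2, hI] at this
    linarith

/-! ### Central limit theorem for perturbed sums of i.i.d. variables. -/

section CLT

variable {Ω : Type*} [MeasurableSpace Ω] {P : Measure Ω}

/-- It suffices to test on measurable rectangles, a generating π-system. Independence of the pairs
is needed because both the steps of the difference walk and the summands of the main term are
functions of them. -/
lemma iIndepFun_prodMk {ι E F : Type*} [MeasurableSpace E] [MeasurableSpace F] {X : ι → Ω → E}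
    {Y : ι → Ω → F} (hX : ∀ i, Measurable (X i)) (hY : ∀ i, Measurable (Y i))
    (hindX : iIndepFun X P) (hindY : iIndepFun Y P)
    (hXY : IndepFun (fun ω i => X i ω) (fun ω i => Y i ω) P) :
    iIndepFun (fun i ω => (X i ω, Y i ω)) P := by
  have hpre : ∀ i (A : Set E) (B : Set F),
      (fun ω => (X i ω, Y i ω)) ⁻¹' (A ×ˢ B) = X i ⁻¹' A ∩ Y i ⁻¹' B := fun i A B => rfl
  refine iIndepSets.iIndep (fun i => ((hX i).prodMk (hY i)).comap_le)
    (fun i => Set.preimage (fun ω => (X i ω, Y i ω)) ''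
      Set.image2 (· ×ˢ ·) {s : Set E | MeasurableSet s} {t : Set F | MeasurableSet t})
    (fun i => ?_) (fun i => ?_) ?_
  · exact isPiSystem_prod.comap (fun ω => (X i ω, Y i ω))
  · rw [← MeasurableSpace.comap_generateFrom, generateFrom_prod]
  · rw [iIndepSets_iff]
    intro s f hf
    have hf' : ∀ i, ∃ (A : Set E) (B : Set F), i ∈ s →
        MeasurableSet A ∧ MeasurableSet B ∧ f i = X i ⁻¹' A ∩ Y i ⁻¹' B := by
      intro i
      by_cases hi : i ∈ s
      · obtain ⟨_, ⟨A, hA, B, hB, rfl⟩, h⟩ := hf i hi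
        exact ⟨A, B, fun _ => ⟨hA, hB, h.symm⟩⟩
      · exact ⟨∅, ∅, fun h => absurd h hi⟩
    choose A B hAB using hf'
    have hmX : MeasurableSet (⋂ i ∈ s, (fun x : ι → E => x i) ⁻¹' A i) :=
      Finset.measurableSet_biInter s fun i hi => measurable_pi_apply i (hAB i hi).1
    have hmY : MeasurableSet (⋂ i ∈ s, (fun x : ι → F => x i) ⁻¹' B i) :=
      Finset.measurableSet_biInter s fun i hi => measurable_pi_apply i (hAB i hi).2.1
    have h1 := hXY.measure_inter_preimage_eq_mul _ _ hmX hmY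
    simp only [Set.preimage_iInter, Set.preimage_preimage] at h1
    have h2 : ∀ i ∈ s, P (f i) = P (X i ⁻¹' A i) * P (Y i ⁻¹' B i) := by
      intro i hi
      rw [(hAB i hi).2.2]
      have hi' : IndepFun (X i) (Y i) P :=
        hXY.comp (φ := fun x : ι → E => x i) (ψ := fun y : ι → F => y i) (measurable_pi_apply i)
          (measurable_pi_apply i)
      exact hi'.measure_inter_preimage_eq_mul _ _ (hAB i hi).1 (hAB i hi).2.1
    rw [Finset.prod_congr rfl h2, Finset.prod_mul_distrib,
      ← hindX.measure_inter_preimage_eq_mul s fun i hi => (hAB i hi).1,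
      ← hindY.measure_inter_preimage_eq_mul s fun i hi => (hAB i hi).2.1]
    refine Eq.trans (congrArg P ?_) h1
    ext ω
    simp only [Set.mem_iInter, Set.mem_inter_iff, Set.mem_preimage]
    constructor
    · intro h
      refine ⟨fun i hi => ?_, fun i hi => ?_⟩
      · have := h i hi
        rw [(hAB i hi).2.2] at this
        exact this.1
      · have := h i hi
        rw [(hAB i hi).2.2] at this
        exact this.2
    · rintro ⟨ha, hb⟩ i hi
      rw [(hAB i hi).2.2]
      exact ⟨ha i hi, hb i hi⟩

variable [IsProbabilityMeasure P]

/-- The Gaussian law has no atoms, so every half-line is a continuity set. -/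
lemma tendsto_cdf_of_tendstoInDistribution {Ω' : Type*} [MeasurableSpace Ω'] {P' : Measure Ω'}
    [IsProbabilityMeasure P'] {X : ℕ → Ω → ℝ} {Y : Ω' → ℝ} (hY : HasLaw Y (gaussianReal 0 1) P')
    (h : TendstoInDistribution X atTop Y (fun _ => P) P') (x : ℝ) :
    Tendsto (fun n => P.real {ω | X n ω ≤ x}) atTop (𝓝 (cdf (gaussianReal 0 1) x)) := by
  have hna : NullSingletonClass (gaussianReal 0 1) := nullSingletonClass_gaussianReal one_ne_zero
  have h1 := ProbabilityMeasure.tendsto_measure_of_null_frontier_of_tendsto' h.tendsto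
    (E := Set.Iic x) (by
      rw [frontier_Iic, ProbabilityMeasure.coe_mk, hY.map_eq]
      exact measure_singleton x)
  simp only [ProbabilityMeasure.coe_mk] at h1
  rw [hY.map_eq] at h1
  have h2 := (ENNReal.tendsto_toReal (measure_ne_top _ _)).comp h1
  rw [cdf_eq_real, Measure.real]
  refine h2.congr fun n => ?_
  rw [Function.comp_apply, Measure.map_apply_of_aemeasurable (h.forall_aemeasurable n)
    measurableSet_Iic]
  rfl

lemma tendstoInMeasure_sub_integral_of_variance {X : ℕ → Ω → ℝ} (hX : ∀ n, MemLp (X n) 2 P)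
    (h : Tendsto (fun n => variance (X n) P) atTop (𝓝 0)) :
    TendstoInMeasure P (fun n ω => X n ω - ∫ ω', X n ω' ∂P) atTop 0 := by
  rw [tendstoInMeasure_iff_norm]
  intro ε hε
  have h1 : Tendsto (fun n => ENNReal.ofReal (variance (X n) P / ε ^ 2)) atTop (𝓝 0) := by
    have := ENNReal.tendsto_ofReal (h.div_const (ε ^ 2))
    simpa using this
  refine tendsto_of_tendsto_of_tendsto_of_le_of_le tendsto_const_nhds h1 (fun n => zero_le)
    fun n => ?_
  simpa using meas_ge_le_variance_div_sq (hX n) hε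

lemma covariance_sq_le {X Y : Ω → ℝ} (hX : MemLp X 2 P) (hY : MemLp Y 2 P) :
    covariance X Y P ^ 2 ≤ variance X P * variance Y P := by
  have h : ∀ t : ℝ, 0 ≤ variance Y P * (t * t) + 2 * covariance X Y P * t + variance X P := by
    intro t
    have h1 := variance_nonneg (X + t • Y) P
    rw [variance_add hX (hY.const_smul t), variance_smul, covariance_smul_right] at h1
    linarith
  have := discrim_le_zero h
  rw [discrim] at this
  linarith

/-- A process which differs from a random walk on the line by `o(√n)` in `L²` satisfies the central
limit theorem, with the variance of the walk. -/
theorem tendsto_cdf_of_approx_partialSum {L : ℕ → Ω → ℝ} {ζ : ℕ → Ω → ℝ}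
    (hL : ∀ n, MemLp (L n) 2 P) (hm : ∀ i, Measurable (ζ i)) (hind : iIndepFun ζ P)
    (hid : ∀ i, IdentDistrib (ζ i) (ζ 0) P P) (hL2 : MemLp (ζ 0) 2 P)
    (hv : 0 < variance (ζ 0) P)
    (hR : Tendsto (fun n : ℕ => (∫ ω, (L n ω - ∑ i ∈ Finset.range n, ζ i ω) ^ 2 ∂P) / n)
      atTop (𝓝 0)) (x : ℝ) :
    Tendsto (fun n : ℕ => P.real {ω | (L n ω - ∫ ω', L n ω' ∂P) / √(variance (L n) P) ≤ x})
      atTop (𝓝 (cdf (gaussianReal 0 1) x)) ∧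
    Tendsto (fun n : ℕ => P.real {ω | (L n ω - ∫ ω', L n ω' ∂P) / √(variance (ζ 0) P * n) ≤ x})
      atTop (𝓝 (cdf (gaussianReal 0 1) x)) := by
  set v := variance (ζ 0) P with hv_def
  set m := ∫ ω, ζ 0 ω ∂P with hm_def
  have hL2' : ∀ i, MemLp (ζ i) 2 P := fun i => (hid i).memLp_iff.2 hL2
  set W : ℕ → Ω → ℝ := fun n ω => ∑ i ∈ Finset.range n, ζ i ω with hW
  have hWL2 : ∀ n, MemLp (W n) 2 P := fun n => memLp_partialSum hL2' _
  have hWmean : ∀ n, ∫ ω, W n ω ∂P = n * m := fun n => by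
    rw [hW, integral_finsetSum _ fun i _ => (hL2' i).integrable (by norm_num)]
    simp [fun i => (hid i).integral_eq, hm_def]
  have hWvar : ∀ n, variance (W n) P = n * v := fun n => by
    have h := IndepFun.variance_sum (s := Finset.range n) (fun i _ => hL2' i)
      fun i _ j _ hij => hind.indepFun hij
    simp only [fun i => (hid i).variance_eq] at h
    have e : W n = ∑ i ∈ Finset.range n, ζ i := by ext ω; simp [hW]
    rw [e, h]
    simp [hv_def]
  set R : ℕ → Ω → ℝ := fun n ω => L n ω - W n ω with hR_def
  have hRL2 : ∀ n, MemLp (R n) 2 P := fun n => (hL n).sub (hWL2 n)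
  have hRvar : Tendsto (fun n : ℕ => variance (R n) P / (v * n)) atTop (𝓝 0) := by
    have h1 := hR.div_const v
    rw [zero_div] at h1
    refine squeeze_zero (fun n => by have := variance_nonneg (R n) P; positivity) (fun n => ?_) h1
    rw [div_div, mul_comm (n : ℝ) v]
    exact div_le_div_of_nonneg_right (variance_le_expectation_sq (hRL2 n).1) (by positivity)
  -- the central limit theorem for the normalized walk
  have hY : HasLaw (id : ℝ → ℝ) (gaussianReal 0 1) (gaussianReal 0 1) := HasLaw.id
  set ζ' : ℕ → Ω → ℝ := fun i ω => (ζ i ω - m) / √v with hζ'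
  have hsq : √v ^ 2 = v := Real.sq_sqrt hv.le
  have hsv : 0 < √v := Real.sqrt_pos.2 hv
  have hφ : Measurable fun x : ℝ => (x - m) / √v := by fun_prop
  have hclt := tendstoInDistribution_inv_sqrt_mul_sum (X := ζ') hY
    (by
      simp only [hζ']
      rw [integral_div, integral_sub (hL2.integrable (by norm_num)) (integrable_const m)]
      simp [hm_def])
    (by
      simp only [Pi.pow_apply, hζ', div_pow, hsq]
      rw [integral_div, ← variance_eq_integral (hm 0).aemeasurable, div_self hv.ne'])
    (hind.comp (fun _ x => (x - m) / √v) fun _ => hφ) (fun i => (hid i).comp hφ)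
  have hsplit : ∀ n : ℕ, √(v * n) = √v * √n := fun n => Real.sqrt_mul hv.le n
  set A : ℕ → Ω → ℝ := fun n ω => (L n ω - ∫ ω', L n ω' ∂P) / √(v * n) with hA
  have hAm : ∀ n, AEMeasurable (A n) P := fun n =>
    ((hL n).1.aemeasurable.sub_const _).div_const _
  -- The difference is exactly the centered, rescaled remainder. Chebyshev's inequality then needs
  -- its variance only, and no asymptotics of the mean of `L n`.
  have hdiff : TendstoInMeasure P
      (A - fun (n : ℕ) ω => (√n)⁻¹ * ∑ k ∈ Finset.range n, ζ' k ω) atTop 0 := by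
    have h1 := tendstoInMeasure_sub_integral_of_variance (P := P)
      (X := fun (n : ℕ) ω => (√(v * n))⁻¹ * R n ω) (fun n => (hRL2 n).const_mul _) (by
        refine hRvar.congr fun n => ?_
        rw [variance_const_mul, inv_pow, Real.sq_sqrt (by positivity), div_eq_inv_mul])
    have e : (A - fun (n : ℕ) ω => (√n)⁻¹ * ∑ k ∈ Finset.range n, ζ' k ω)
        = fun (n : ℕ) ω => (√(v * n))⁻¹ * R n ω - ∫ ω', (√(v * n))⁻¹ * R n ω' ∂P := by
      ext n ω
      simp only [Pi.sub_apply, hA, hζ']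
      rw [integral_const_mul, ← Finset.sum_div, Finset.sum_sub_distrib]
      simp only [hR_def]
      rw [integral_sub ((hL n).integrable (by norm_num)) ((hWL2 n).integrable (by norm_num)),
        hWmean, hsplit]
      simp only [hW, Finset.sum_const, Finset.card_range, nsmul_eq_mul, mul_inv]
      field_simp
      ring
    rw [e]
    exact h1
  have hAd : TendstoInDistribution A atTop id (fun _ => P) (gaussianReal 0 1) :=
    tendstoInDistribution_of_tendstoInMeasure_sub A id hclt hdiff hAm
  refine ⟨?_, tendsto_cdf_of_tendstoInDistribution hY hAd x⟩
  -- comparison of the variances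
  have hratio : Tendsto (fun n : ℕ => variance (L n) P / (v * n)) atTop (𝓝 1) := by
    -- By Cauchy–Schwarz the covariance is at most the root of `n * v` times an `o(n)` variance,
    -- hence `o(n)`.
    have hcov : Tendsto (fun n : ℕ => covariance (W n) (R n) P / (v * n)) atTop (𝓝 0) := by
      have h1 := (Real.continuous_sqrt.tendsto 0).comp hRvar
      rw [Real.sqrt_zero] at h1
      refine squeeze_zero_norm (fun n => ?_) h1
      rw [Function.comp_apply, Real.norm_eq_abs]
      refine Real.abs_le_sqrt ?_
      have h2 := covariance_sq_le (hWL2 n) (hRL2 n)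
      rw [hWvar] at h2
      rcases Nat.eq_zero_or_pos n with hn | hn
      · simp [hn]
      · have hn' : (0 : ℝ) < n := by exact_mod_cast hn
        rw [div_pow, div_le_div_iff₀ (by positivity) (by positivity)]
        calc covariance (W n) (R n) P ^ 2 * (v * n)
            ≤ (n * v * variance (R n) P) * (v * n) := by gcongr
          _ = variance (R n) P * (v * n) ^ 2 := by ring
    have h2 := ((tendsto_const_nhds (x := (1 : ℝ))).add (hcov.const_mul 2)).add hRvar
    rw [mul_zero, add_zero, add_zero] at h2
    refine h2.congr' ?_
    filter_upwards [eventually_gt_atTop 0] with n hn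
    have hn' : (0 : ℝ) < n := by exact_mod_cast hn
    have e : L n = W n + R n := by ext ω; simp [hR_def]
    rw [e, variance_add (hWL2 n) (hRL2 n), hWvar]
    field_simp
  set c : ℕ → ℝ := fun n => √(v * n) / √(variance (L n) P) with hc
  have hc1 : Tendsto c atTop (𝓝 1) := by
    have h1 := (Real.continuous_sqrt.tendsto 1).comp (hratio.inv₀ one_ne_zero |>.trans
      (by rw [inv_one]))
    rw [Real.sqrt_one] at h1
    refine h1.congr fun n => ?_
    rw [Function.comp_apply, inv_div, Real.sqrt_div (by positivity)]
  have hcm : TendstoInMeasure P (fun n (_ : Ω) => c n) atTop (fun _ => (1 : ℝ)) :=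
    tendstoInMeasure_of_tendsto_ae (fun n => aestronglyMeasurable_const) (ae_of_all _ fun _ => hc1)
  -- Slutsky's lemma: the factor `c n` exchanges the two normalizations and tends to 1.
  have hprod := hAd.continuous_comp_prodMk_of_tendstoInMeasure_const
    (g := fun p : ℝ × ℝ => p.1 * p.2) (by fun_prop) hcm fun n => aemeasurable_const
  simp only [mul_one] at hprod
  refine (tendsto_cdf_of_tendstoInDistribution hY hprod x).congr' ?_
  filter_upwards [eventually_gt_atTop 0] with n hn
  have hn' : (0 : ℝ) < n := by exact_mod_cast hn
  have hne : √(v * n) ≠ 0 := (Real.sqrt_pos.2 (by positivity)).ne'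
  congr 1
  ext ω
  simp only [hA, hc, Set.mem_ofPred_eq]
  rw [div_mul_div_comm, mul_comm _ (√(v * n)), mul_div_mul_left _ _ hne]

end CLT

/-! ### The limiting variance. -/

section Covariance

variable {Ω : Type*} [MeasurableSpace Ω] {P : Measure Ω}

lemma memLp_inner_const {X : Ω → Plane} (hX : MemLp X 2 P) (u : Plane) :
    MemLp (fun ω => inner ℝ (X ω) u) 2 P := by
  refine (hX.norm.mul_const ‖u‖).mono (hX.1.inner aestronglyMeasurable_const)
    (ae_of_all _ fun ω => ?_)
  rw [norm_mul, norm_norm, norm_norm]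
  exact norm_inner_le_norm (X ω) u

variable [IsProbabilityMeasure P]

lemma variance_inner_const {X : Ω → Plane} (hX : MemLp X 2 P) (u : Plane) :
    variance (fun ω => inner ℝ (X ω) u) P = ∫ ω, inner ℝ (X ω - meanVec P X) u ^ 2 ∂P := by
  rw [variance_eq_integral (memLp_inner_const hX u).1.aemeasurable]
  have h : ∫ ω, inner ℝ (X ω) u ∂P = inner ℝ (meanVec P X) u := by
    simp only [real_inner_comm u, meanVec]
    exact integral_inner (hX.integrable (by norm_num)) _
  simp only [h, inner_sub_left]

/-- The covariance matrix enters as the cross term of the expanded square; this explains the mixed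
terms of σ_L². -/
lemma integral_inner_add_sq {X : Ω → Plane} (hX : MemLp X 2 P) (e p : Plane) :
    ∫ ω, inner ℝ (X ω - meanVec P X) (e + p) ^ 2 ∂P
      = ∫ ω, inner ℝ (X ω - meanVec P X) e ^ 2 ∂P + ∫ ω, inner ℝ (X ω - meanVec P X) p ^ 2 ∂P
        + 2 * inner ℝ ((covMatrix P X).toEuclideanLin e) p := by
  set D : Ω → Plane := fun ω => X ω - meanVec P X with hD
  have hDL2 : MemLp D 2 P := hX.sub (memLp_const _)
  have hDe := memLp_inner_const hDL2 e
  have hDp := memLp_inner_const hDL2 p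
  have hDi : ∀ i, MemLp (fun ω => D ω i) 2 P := fun i => by
    refine hDL2.norm.mono ?_ (ae_of_all _ fun ω => ?_)
    · exact (EuclideanSpace.proj (𝕜 := ℝ) i).continuous.comp_aestronglyMeasurable hDL2.1
    · rw [norm_norm]; exact PiLp.norm_apply_le (D ω) i
  have hDij : ∀ i j, Integrable (fun ω => D ω i * D ω j) P := fun i j =>
    (hDi i).integrable_mul (hDi j)
  have hcov : inner ℝ ((covMatrix P X).toEuclideanLin e) p
      = ∫ ω, inner ℝ (D ω) e * inner ℝ (D ω) p ∂P := by
    have h1 : ∀ ω, inner ℝ (D ω) e * inner ℝ (D ω) p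
        = (D ω 0 * D ω 0) * (e 0 * p 0) + (D ω 0 * D ω 1) * (e 1 * p 0)
          + (D ω 1 * D ω 0) * (e 0 * p 1) + (D ω 1 * D ω 1) * (e 1 * p 1) := fun ω => by
      rw [Plane.inner_eq, Plane.inner_eq]; ring
    simp only [h1]
    rw [integral_add (f := fun ω => (D ω 0 * D ω 0) * (e 0 * p 0) + (D ω 0 * D ω 1) * (e 1 * p 0)
          + (D ω 1 * D ω 0) * (e 0 * p 1))
        ((((hDij 0 0).mul_const _).add ((hDij 0 1).mul_const _)).add ((hDij 1 0).mul_const _))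
        ((hDij 1 1).mul_const _),
      integral_add (f := fun ω => (D ω 0 * D ω 0) * (e 0 * p 0) + (D ω 0 * D ω 1) * (e 1 * p 0))
        (((hDij 0 0).mul_const _).add ((hDij 0 1).mul_const _)) ((hDij 1 0).mul_const _),
      integral_add ((hDij 0 0).mul_const _) ((hDij 0 1).mul_const _)]
    simp only [integral_mul_const]
    rw [Plane.inner_eq]
    simp only [Matrix.toLpLin_apply, Matrix.mulVec, dotProduct, Fin.sum_univ_two, covMatrix,
      Matrix.of_apply]
    simp only [hD]
    ring
  rw [hcov, ← integral_const_mul, ← integral_add hDe.integrable_sq hDp.integrable_sq,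
    ← integral_add (f := fun ω => inner ℝ (D ω) e ^ 2 + inner ℝ (D ω) p ^ 2)
      (g := fun ω => 2 * (inner ℝ (D ω) e * inner ℝ (D ω) p))
      (hDe.integrable_sq.add hDp.integrable_sq) ((hDe.integrable_mul hDp).const_mul 2)]
  refine integral_congr_ae (ae_of_all _ fun ω => ?_)
  simp only [inner_add_right]
  ring

/-- `σ_L²` is the variance of a sum of projections of the steps. -/
lemma sigmaLSq_eq_variance {X₁ X₂ : Ω → Plane} (h₁ : MemLp X₁ 2 P) (h₂ : MemLp X₂ 2 P)
    (hind : IndepFun X₁ X₂ P) (e₁ e₂ p : Plane) :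
    sigmaLSq P X₁ X₂ e₁ e₂ p
      = variance (fun ω => inner ℝ (X₁ ω) (e₁ + p) + inner ℝ (X₂ ω) (e₂ - p)) P := by
  have hu : ∀ u : Plane, Measurable fun v : Plane => inner ℝ v u := fun u =>
    measurable_id.inner measurable_const
  rw [IndepFun.variance_fun_add (memLp_inner_const h₁ _) (memLp_inner_const h₂ _)
    (hind.comp (hu _) (hu _)), variance_inner_const h₁, variance_inner_const h₂, sub_eq_add_neg e₂,
    integral_inner_add_sq h₁, integral_inner_add_sq h₂, sigmaLSq]
  simp only [inner_neg_right, neg_sq]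
  ring

end Covariance

/-! ### Linear approximation of the perimeter and conclusion. -/

lemma unitVec_eq_of_polar {μ : Plane} (hμ : μ ≠ 0) {θ : ℝ} (h : μ = ‖μ‖ • unitVec θ) :
    ‖μ‖⁻¹ • μ = unitVec θ := by
  nth_rewrite 2 [h]
  rw [smul_smul, inv_mul_cancel₀ (norm_ne_zero_iff.2 hμ), one_smul]

/-- In the plane, the two vectors orthogonal to a given direction are parallel. -/
lemma eq_normalize_of_inner_eq_zero {δ p : Plane} (hδ : δ ≠ 0) (hp : ‖p‖ = 1) {θ : ℝ}
    (h1 : inner ℝ δ (unitVec θ) = 0) (h2 : inner ℝ p (unitVec θ) = 0) (h3 : 0 ≤ inner ℝ p δ) :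
    p = ‖δ‖⁻¹ • δ := by
  have hcs := Real.cos_sq_add_sin_sq θ
  have hp2 : p 0 ^ 2 + p 1 ^ 2 = 1 := by
    have := real_inner_self_eq_norm_sq p
    rw [hp, Plane.inner_eq] at this
    linarith
  simp only [Plane.inner_eq, unitVec, Matrix.cons_val_zero, Matrix.cons_val_one] at h1 h2
  have e : δ = (inner ℝ p δ) • p := by
    have hcross : δ 0 * p 1 - δ 1 * p 0 = 0 := by
      have a1 : (δ 0 * p 1 - δ 1 * p 0) * Real.cos θ = 0 := by
        linear_combination p 1 * h1 - δ 1 * h2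
      have a2 : (δ 0 * p 1 - δ 1 * p 0) * Real.sin θ = 0 := by
        linear_combination δ 0 * h2 - p 0 * h1
      linear_combination Real.cos θ * a1 + Real.sin θ * a2 - (δ 0 * p 1 - δ 1 * p 0) * hcs
    rw [Plane.ext_iff, Plane.inner_eq]
    simp only [PiLp.smul_apply, smul_eq_mul]
    constructor
    · linear_combination (-δ 0) * hp2 + p 1 * hcross
    · linear_combination (-δ 1) * hp2 - p 0 * hcross
  have hn : ‖δ‖ = inner ℝ p δ := by
    nth_rewrite 1 [e]
    rw [norm_smul, hp, mul_one, Real.norm_of_nonneg h3]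
  have hne : inner ℝ p δ ≠ 0 := hn ▸ norm_ne_zero_iff.2 hδ
  have e' : (inner ℝ p δ)⁻¹ • δ = (inner ℝ p δ)⁻¹ • inner ℝ p δ • p := congrArg _ e
  rw [hn, e', smul_smul, inv_mul_cancel₀ hne, one_smul]

section Perimeter

variable {Ω : Type*} [MeasurableSpace Ω]

/-- Measurability is not visible from the sum over sides; Cauchy's formula exhibits the perimeter as
a parameter integral of a jointly measurable function. -/
lemma measurable_perimeterProcess {Z₁ Z₂ : ℕ → Ω → Plane} (hZ₁ : ∀ i, Measurable (Z₁ i))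
    (hZ₂ : ∀ i, Measurable (Z₂ i)) (n : ℕ) : Measurable (perimeterProcess Z₁ Z₂ n) := by
  have hs : ((Finset.range (n + 1)).disjSum (Finset.range (n + 1))).Nonempty :=
    ⟨Sum.inl 0, by simp⟩
  have hm := measurable_spread_inner hs (f := Sum.elim (walk Z₁) (walk Z₂)) (by
    rintro (i | i)
    · exact measurable_walk hZ₁ i
    · exact measurable_walk hZ₂ i)
  have h : perimeterProcess Z₁ Z₂ n = fun ω => 2⁻¹ * ∫ θ, spread _ hs
      (fun k => inner ℝ (Sum.elim (walk Z₁) (walk Z₂) k ω) (unitVec θ)) ∂angleMeasure := by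
    ext ω
    have e : ∀ k, Sum.elim (fun j => walk Z₁ j ω) (fun j => walk Z₂ j ω) k
        = Sum.elim (walk Z₁) (walk Z₂) k ω := by rintro (k | k) <;> rfl
    have := perimeter_pair_eq (fun j => walk Z₁ j ω) (fun j => walk Z₂ j ω) n hs
    simp only [e] at this
    exact this
  rw [h]
  exact (hm.stronglyMeasurable.integral_prod_right (ν := angleMeasure)).measurable.const_mul _

/-- The perimeter of the hull of two walks with nonzero, distinct drifts is approximated in `L²`, up
to `o(√n)`, by a linear function of the endpoints of the walks. -/
theorem perimeterProcess_approx {P : Measure Ω} [IsProbabilityMeasure P] {Z₁ Z₂ : ℕ → Ω → Plane}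
    (hZ₁ : ∀ i, Measurable (Z₁ i)) (hZ₂ : ∀ i, Measurable (Z₂ i))
    (hpair : iIndepFun (fun i ω => (Z₁ i ω, Z₂ i ω)) P)
    (hid : ∀ i, IdentDistrib (fun ω => (Z₁ i ω, Z₂ i ω)) (fun ω => (Z₁ 0 ω, Z₂ 0 ω)) P P)
    (hL2₁ : MemLp (Z₁ 0) 2 P) (hL2₂ : MemLp (Z₂ 0) 2 P) {a b : Plane}
    (ha : a = meanVec P (Z₁ 0)) (hb : b = meanVec P (Z₂ 0)) (ha0 : a ≠ 0) (hb0 : b ≠ 0)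
    (hab0 : a - b ≠ 0) :
    let R : ℕ → Ω → ℝ := fun n ω => perimeterProcess Z₁ Z₂ n ω
      - (inner ℝ (walk Z₁ n ω) (‖a‖⁻¹ • a) + inner ℝ (walk Z₂ n ω) (‖b‖⁻¹ • b)
        + inner ℝ (walk Z₁ n ω - walk Z₂ n ω) (‖a - b‖⁻¹ • (a - b)))
    (∀ n, MemLp (R n) 2 P) ∧
      Tendsto (fun n : ℕ => (∫ ω, R n ω ^ 2 ∂P) / n) atTop (𝓝 0) := by
  intro R
  have hsub : Measurable fun q : Plane × Plane => q.1 - q.2 := measurable_fst.sub measurable_snd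
  have hab : a - b = meanVec P (fun ω => Z₁ 0 ω - Z₂ 0 ω) := by
    rw [ha, hb, meanVec, meanVec, meanVec,
      integral_sub (hL2₁.integrable (by norm_num)) (hL2₂.integrable (by norm_num))]
  obtain ⟨m1, t1⟩ := integral_angleExcess_moments (P := P) (Z := Z₁) hZ₁
    (hpair.comp (fun _ q => q.1) fun _ => measurable_fst) (fun i => (hid i).comp measurable_fst)
    hL2₁ (ha ▸ ha0)
  obtain ⟨m2, t2⟩ := integral_angleExcess_moments (P := P) (Z := Z₂) hZ₂
    (hpair.comp (fun _ q => q.2) fun _ => measurable_snd) (fun i => (hid i).comp measurable_snd)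
    hL2₂ (hb ▸ hb0)
  obtain ⟨m3, t3⟩ := integral_angleExcess_moments (P := P) (Z := fun i ω => Z₁ i ω - Z₂ i ω)
    (fun i => (hZ₁ i).sub (hZ₂ i)) (hpair.comp (fun _ q => q.1 - q.2) fun _ => hsub)
    (fun i => (hid i).comp hsub) (hL2₁.sub hL2₂) (hab ▸ hab0)
  rw [← ha] at m1 t1
  rw [← hb] at m2 t2
  rw [← hab] at m3 t3
  have hwalk : ∀ j ω, walk (fun i ω => Z₁ i ω - Z₂ i ω) j ω = walk Z₁ j ω - walk Z₂ j ω :=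
    fun j ω => Finset.sum_sub_distrib _ _
  simp only [hwalk] at m3 t3
  set G1 : ℕ → Ω → ℝ := fun n ω =>
    ∫ θ, angleExcess a (fun j => walk Z₁ j ω) n θ ∂angleMeasure with hG1
  set G2 : ℕ → Ω → ℝ := fun n ω =>
    ∫ θ, angleExcess b (fun j => walk Z₂ j ω) n θ ∂angleMeasure with hG2
  set G3 : ℕ → Ω → ℝ := fun n ω =>
    ∫ θ, angleExcess (a - b) (fun j => walk Z₁ j ω - walk Z₂ j ω) n θ ∂angleMeasure with hG3
  have hR : ∀ n ω, 0 ≤ R n ω ∧ R n ω ≤ G1 n ω + G2 n ω + G3 n ω := fun n ω => by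
    obtain ⟨h1, h2⟩ := perimeter_pair_bounds ha0 hb0 hab0 (fun j => walk Z₁ j ω)
      (fun j => walk Z₂ j ω) (by simp [walk]) (by simp [walk]) n
    exact ⟨sub_nonneg.2 h1, sub_le_iff_le_add'.2 h2⟩
  have hu : ∀ u : Plane, Measurable fun v : Plane => inner ℝ v u := fun u =>
    measurable_id.inner measurable_const
  have hRm : ∀ n, Measurable (R n) := fun n =>
    (measurable_perimeterProcess hZ₁ hZ₂ n).sub
      ((((hu _).comp (measurable_walk hZ₁ n)).add ((hu _).comp (measurable_walk hZ₂ n))).add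
        ((hu _).comp ((measurable_walk hZ₁ n).sub (measurable_walk hZ₂ n))))
  have hRL2 : ∀ n, MemLp (R n) 2 P := fun n =>
    (((m1 n).add (m2 n)).add (m3 n)).mono (hRm n).aestronglyMeasurable (ae_of_all _ fun ω => by
      obtain ⟨h1, h2⟩ := hR n ω
      rw [Real.norm_of_nonneg h1]
      exact h2.trans (le_abs_self _))
  refine ⟨hRL2, ?_⟩
  -- The 3 comes from bounding the square of a sum of three terms by the sum of squares.
  have hsum := ((t1.add t2).add t3).const_mul 3
  rw [add_zero, add_zero, mul_zero] at hsum
  refine squeeze_zero (fun n => div_nonneg (integral_nonneg fun ω => sq_nonneg _)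
    (Nat.cast_nonneg n)) (fun n => ?_) hsum
  have i1 := (m1 n).integrable_sq
  have i2 := (m2 n).integrable_sq
  have i3 := (m3 n).integrable_sq
  rw [← add_div, ← add_div, ← mul_div_assoc]
  refine div_le_div_of_nonneg_right ?_ (Nat.cast_nonneg n)
  rw [← integral_add i1 i2, ← integral_add (f := fun ω => G1 n ω ^ 2 + G2 n ω ^ 2) (i1.add i2) i3,
    ← integral_const_mul]
  refine integral_mono (hRL2 n).integrable_sq (((i1.add i2).add i3).const_mul 3) fun ω => ?_
  obtain ⟨h1, h2⟩ := hR n ω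
  have h3 := pow_le_pow_left₀ h1 h2 2
  simp only
  nlinarith [sq_nonneg (G1 n ω - G2 n ω), sq_nonneg (G1 n ω - G3 n ω), sq_nonneg (G2 n ω - G3 n ω)]

end Perimeter

theorem mainTheorem1 {Ω : Type*} [MeasurableSpace Ω] (P : Measure Ω) [IsProbabilityMeasure P]
    (Z₁ Z₂ : ℕ → Ω → Plane)
    -- two mutually independent sequences of i.i.d. square integrable random vectors
    (hZ₁ : ∀ i, Measurable (Z₁ i)) (hZ₂ : ∀ i, Measurable (Z₂ i))
    (hindep₁ : iIndepFun Z₁ P) (hindep₂ : iIndepFun Z₂ P)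
    (hindep : IndepFun (fun ω i => Z₁ i ω) (fun ω i => Z₂ i ω) P)
    (hident₁ : ∀ i, IdentDistrib (Z₁ i) (Z₁ 0) P P)
    (hident₂ : ∀ i, IdentDistrib (Z₂ i) (Z₂ 0) P P)
    (hL2₁ : MemLp (Z₁ 0) 2 P) (hL2₂ : MemLp (Z₂ 0) 2 P)
    -- the drift vectors
    (μ₁ μ₂ : Plane) (hμ₁ : μ₁ = meanVec P (Z₁ 0)) (hμ₂ : μ₂ = meanVec P (Z₂ 0))
    (hA1 : (0 : Plane) ∉ ({μ₁, μ₂, μ₁ - μ₂} : Set Plane))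
    -- the angles of the drift vectors
    (θ₁ θ₂ : ℝ) (hθ₁ : θ₁ ∈ Set.Ico 0 (2 * Real.pi)) (hθ₂ : θ₂ ∈ Set.Ico 0 (2 * Real.pi))
    (hpolar₁ : μ₁ = ‖μ₁‖ • unitVec θ₁) (hpolar₂ : μ₂ = ‖μ₂‖ • unitVec θ₂)
    -- the direction along which the drift vectors have equal projections
    (θ₀ : ℝ) (hθ₀ : θ₀ ∈ Set.Ico 0 (2 * Real.pi))
    (hproj : inner ℝ μ₁ (unitVec θ₀) = inner ℝ μ₂ (unitVec θ₀))
    -- the unit vector perpendicular to that direction, oriented from the second to the first drift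
    (ePerp : Plane) (hnorm : ‖ePerp‖ = 1) (hperp : inner ℝ ePerp (unitVec θ₀) = 0)
    (horient : 0 ≤ inner ℝ ePerp (μ₁ - μ₂))
    (σsq : ℝ) (hσsq : σsq = sigmaLSq P (Z₁ 0) (Z₂ 0) (unitVec θ₁) (unitVec θ₂) ePerp)
    (hσ : 0 < σsq)
    (L : ℕ → Ω → ℝ) (hL : L = perimeterProcess Z₁ Z₂) :
    (∀ n, MemLp (L n) 2 P) ∧
    (∀ x : ℝ, Tendsto
      (fun n : ℕ => P.real {ω | (L n ω - ∫ ω', L n ω' ∂P) / √(variance (L n) P) ≤ x})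
      atTop (𝓝 (cdf (gaussianReal 0 1) x))) ∧
    (∀ x : ℝ, Tendsto
      (fun n : ℕ => P.real {ω | (L n ω - ∫ ω', L n ω' ∂P) / √(σsq * n) ≤ x})
      atTop (𝓝 (cdf (gaussianReal 0 1) x))) := by
  have hμ₁0 : μ₁ ≠ 0 := fun h => hA1 (by simp [h])
  have hμ₂0 : μ₂ ≠ 0 := fun h => hA1 (by simp [h])
  have hμ0 : μ₁ - μ₂ ≠ 0 := fun h => hA1 (by simp [h])
  have hdir₁ := unitVec_eq_of_polar hμ₁0 hpolar₁
  have hdir₂ := unitVec_eq_of_polar hμ₂0 hpolar₂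
  have hdir := eq_normalize_of_inner_eq_zero hμ0 hnorm
    (by rw [inner_sub_left, hproj, sub_self]) hperp horient
  have hpair := iIndepFun_prodMk hZ₁ hZ₂ hindep₁ hindep₂ hindep
  have hind12 : ∀ i, IndepFun (Z₁ i) (Z₂ i) P := fun i =>
    hindep.comp (φ := fun x : ℕ → Plane => x i) (ψ := fun y : ℕ → Plane => y i)
      (measurable_pi_apply i) (measurable_pi_apply i)
  have hid : ∀ i, IdentDistrib (fun ω => (Z₁ i ω, Z₂ i ω)) (fun ω => (Z₁ 0 ω, Z₂ 0 ω)) P P :=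
    fun i => (hident₁ i).prodMk (hident₂ i) (hind12 i) (hind12 0)
  obtain ⟨hRL2, hRlim⟩ := perimeterProcess_approx hZ₁ hZ₂ hpair hid hL2₁ hL2₂ hμ₁ hμ₂ hμ₁0 hμ₂0 hμ0
  rw [hdir₁, hdir₂, ← hdir] at hRL2 hRlim
  -- Collecting the coefficients of each endpoint: the third side of the triangle adds `ePerp` to
  -- the direction of the first walk and subtracts it from that of the second.
  set ζ : ℕ → Ω → ℝ := fun i ω =>
    inner ℝ (Z₁ i ω) (unitVec θ₁ + ePerp) + inner ℝ (Z₂ i ω) (unitVec θ₂ - ePerp) with hζ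
  have hW : ∀ n ω, inner ℝ (walk Z₁ n ω) (unitVec θ₁) + inner ℝ (walk Z₂ n ω) (unitVec θ₂)
      + inner ℝ (walk Z₁ n ω - walk Z₂ n ω) ePerp = ∑ i ∈ Finset.range n, ζ i ω := fun n ω => by
    simp only [hζ]
    rw [Finset.sum_add_distrib, ← inner_walk, ← inner_walk, inner_add_right, inner_sub_right,
      inner_sub_left]
    ring
  simp only [hW] at hRL2 hRlim
  have hφ : Measurable fun q : Plane × Plane =>
      inner ℝ q.1 (unitVec θ₁ + ePerp) + inner ℝ q.2 (unitVec θ₂ - ePerp) :=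
    (measurable_fst.inner measurable_const).add (measurable_snd.inner measurable_const)
  have hζm : ∀ i, Measurable (ζ i) := fun i => hφ.comp ((hZ₁ i).prodMk (hZ₂ i))
  have hζid : ∀ i, IdentDistrib (ζ i) (ζ 0) P P := fun i => (hid i).comp hφ
  have hζL2 : MemLp (ζ 0) 2 P := (memLp_inner_const hL2₁ _).add (memLp_inner_const hL2₂ _)
  have hζind : iIndepFun ζ P := hpair.comp _ fun _ => hφ
  have hvar : variance (ζ 0) P = σsq := by
    rw [hσsq, sigmaLSq_eq_variance hL2₁ hL2₂ (hind12 0)]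
  have hLL2 : ∀ n, MemLp (L n) 2 P := fun n => by
    have h := (hRL2 n).add
      (memLp_partialSum (fun i => (hζid i).memLp_iff.2 hζL2) (Finset.range n))
    refine h.congr_norm (hL ▸ (measurable_perimeterProcess hZ₁ hZ₂ n).aestronglyMeasurable)
      (ae_of_all _ fun ω => ?_)
    simp [hL]
  have hclt := tendsto_cdf_of_approx_partialSum hLL2 hζm hζind hζid hζL2 (by rwa [hvar])
    (by rw [hL]; exact hRlim)
  rw [hvar] at hclt
  exact ⟨hLL2, fun x => (hclt x).1, fun x => (hclt x).2⟩
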